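/- **Setting.** Let $n$ agents solve the resource allocation problem $$\min_{\mathbf w_1,\dots,\mathbf w_n\in\mathbb R^m}\ \sum_{i=1}^n F_i(\mathbf w_i)\quad\text{s.t.}\quad \sum_{i=1}^n\mathbf w_i=\sum_{i=1}^n\mathbf d_i,\qquad \mathbf w_i\in\mathcal W_i\ (i=1,\dots,n),$$ where $F_i:\mathbb R^m\to\mathbb R$, $\mathbf d_i\in\mathbb R^m$ and $\mathcal W_i\subseteq\mathbb R^m$ is closed and convex. Assume: 1. each $F_i$ is $\frac1L$-strongly convex on $\mathbb R^m$ ($L>0$), and (Slater) some point of the relative interior of $\mathcal W_1\times\cdots\times\mathcal W_n$ satisfies $\sum_i\mathbf w_i=\sum_i\mathbf d_i$; 2. for a nonnegative matrix $A\in\mathbb R^{n\times n}$ let $\mathcal G_A$ be the directed graph in which node $i$ receives information from node $j$ iff $a_{ij}>0$. The nonnegative matrices $R=[r_{ij}],C=[c_{ij}]\in\mathbb R^{n\times n}$ are such that some node $r$ is the root of a spanning tree of $\mathcal G_R$ and also of a spanning tree of $\mathcal G_{C^\top}$, and $r$ is aperiodic in both graphs, i.e. the greatest common divisor of the lengths of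 the closed walks through $r$ is $1$ (for example $r_{rr}>0$ and $c_{rr}>0$); 3. $R$ is row-stochastic and $C$ is column-stochastic; 4. the real triggering thresholds $e_{\tilde{\mathbf w}_i,k},e_{\mathbf s_i,k}$ ($i=1,\dots,n$, $k\ge 0$) are such that $e_k=\max_{i}\max(e_{\tilde{\mathbf w}_i,k},e_{\mathbf s_i,k})$ is non-increasing in $k$ and $\sum_{k\ge0}e_k<\infty$. **Algorithm (ET-DGT) with step size $\alpha>0$.** Start with $\tilde{\mathbf w}_{i,0}=\mathbf 0$, $\mathbf w_{i,0}=\mathbf 0$, $\mathbf s_{i,0}=\mathbf d_i-\mathbf w_{i,0}$, and for $k\ge 0$ let $$\tilde{\mathbf w}_{i,k+1}=\tilde{\mathbf w}_{i,k}+\sum_{j=1}^n r_{ij}(\hat{\mathbf w}_{j,k}-\hat{\mathbf w}_{i,k})+\alpha\,\mathbf s_{i,k},\qquad \mathbf w_{i,k+1}=\operatorname*{arg\,min}_{\mathbf w\in\mathcal W_i}\{F_i(\mathbf w)-\tilde{\mathbf w}_{i,k+1}^\top\mathbf w\},$$ $$\mathbf s_{i,k+1}=\mathbf s_{i,k}+\Big(\sum_{j=1}^n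 c_{ij}\hat{\mathbf s}_{j,k}-\hat{\mathbf s}_{i,k}\Big)-(\mathbf w_{i,k+1}-\mathbf w_{i,k}).$$ Here $\hat{\mathbf w}_{i,k}$ and $\hat{\mathbf s}_{i,k}$ are the last broadcast values of $\tilde{\mathbf w}_i$ and $\mathbf s_i$ up to time $k$: both are broadcast at time $0$, and if $t$ is a broadcast time of $\tilde{\mathbf w}_i$, its next broadcast time is the first $k>t$ with $\|\tilde{\mathbf w}_{i,k}-\tilde{\mathbf w}_{i,t}\|\ge e_{\tilde{\mathbf w}_i,k}$; likewise for $\mathbf s_i$ with $e_{\mathbf s_i,k}$. **Theorem.** The problem has a unique optimal allocation $\mathbf W^*=(\mathbf w_1^*,\dots,\mathbf w_n^*)$. If the constant step size $\alpha>0$ is sufficiently small, i.e. $\alpha<\bar\alpha$ for some $\bar\alpha>0$ that depends only on $n$, $R$, $C$ and $L$, then the primal iterates $\mathbf W_k=(\mathbf w_{1,k},\dots,\mathbf w_{n,k})$ of ET-DGT converge to $\mathbf W^*$ as $k\to\infty$. -/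

import Mathlib

open Filter Topology
open scoped Matrix

namespace ETDGT

/-- The decision space `ℝ^m` with its Euclidean norm. -/
abbrev Vec (m : ℕ) : Type := EuclideanSpace ℝ (Fin m)

/-- The data of the resource allocation problem
`min ∑ i, F i (w i)` subject to `∑ i, w i = ∑ i, d i` and `w i ∈ W i` for every agent `i`. -/
structure Problem (n m : ℕ) where
  /-- local cost functions -/
  F : Fin n → Vec m → ℝ
  /-- local constraint sets -/
  W : Fin n → Set (Vec m)
  /-- local demands -/
  d : Fin n → Vec m

namespace Problem

variable {n m : ℕ}

/-- An allocation is feasible if it satisfies the local constraints and the balance constraint. -/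
def IsFeasible (P : Problem n m) (V : Fin n → Vec m) : Prop :=
  (∀ i, V i ∈ P.W i) ∧ ∑ i, V i = ∑ i, P.d i

/-- An optimal allocation: feasible, and of least total cost among the feasible allocations. -/
def IsOptimal (P : Problem n m) (V : Fin n → Vec m) : Prop :=
  P.IsFeasible V ∧ ∀ U, P.IsFeasible U → ∑ i, P.F i (V i) ≤ ∑ i, P.F i (U i)

/-- Slater's condition: some point of the relative interior of `W 1 × ⋯ × W n` satisfies the
balance constraint. -/
def Slater (P : Problem n m) : Prop :=
  ∃ V ∈ intrinsicInterior ℝ (Set.univ.pi P.W), ∑ i, V i = ∑ i, P.d i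

end Problem

/-- The directed graph of a nonnegative matrix `A`: node `i` receives information from node `j`
iff `0 < A i j`. The node `r` is the root of a spanning tree of this graph iff every node can be
reached from `r` along the flow of information. -/
def IsSpanningRoot {n : ℕ} (A : Matrix (Fin n) (Fin n) ℝ) (r : Fin n) : Prop :=
  ∀ i, Relation.ReflTransGen (fun j i => 0 < A i j) r i

/-- The node `r` is aperiodic in the graph of the nonnegative matrix `A`: the greatest common
divisor of the lengths of the closed walks through `r` is `1`. There is a closed walk of length `k`
through `r` iff the entry `(r, r)` of `A ^ k` is positive. -/
def IsAperiodicAt {n : ℕ} (A : Matrix (Fin n) (Fin n) ℝ) (r : Fin n) : Prop :=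
  ∀ p : ℕ, (∀ k : ℕ, 0 < k → 0 < (A ^ k) r r → p ∣ k) → p = 1

open Classical in
/-- The last broadcast value at time `k` of a signal `v` under the thresholds `e`. Time `0` is a
triggering instant; after the last triggering instant `t`, with broadcast value `v t`, the next one
is the first `k > t` with `e k ≤ ‖v k - v t‖`. -/
noncomputable def broadcast {m : ℕ} (e : ℕ → ℝ) (v : ℕ → Vec m) : ℕ → Vec m
  | 0 => v 0
  | k + 1 => if e (k + 1) ≤ ‖v (k + 1) - broadcast e v k‖ then v (k + 1) else broadcast e v k

/-- The largest triggering threshold over all agents at time `k`. -/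
noncomputable def maxThreshold {n : ℕ} (ew es : Fin n → ℕ → ℝ) (k : ℕ) : ℝ :=
  ⨆ i, max (ew i k) (es i k)

/-- The sequences `wt` (dual estimates), `w` (primal iterates) and `s` (gradient trackers) are the
execution of the event-triggered dual gradient tracking algorithm with weights `R`, `C`, step size
`α` and triggering thresholds `ew` (for `wt`) and `es` (for `s`). -/
structure IsRun {n m : ℕ} (P : Problem n m) (R C : Matrix (Fin n) (Fin n) ℝ) (α : ℝ)
    (ew es : Fin n → ℕ → ℝ) (wt w s : ℕ → Fin n → Vec m) : Prop where
  wt_zero : ∀ i, wt 0 i = 0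
  w_zero : ∀ i, w 0 i = 0
  s_zero : ∀ i, s 0 i = P.d i - w 0 i
  wt_succ : ∀ k i, wt (k + 1) i = wt k i
    + ∑ j, R i j • (broadcast (ew j) (fun t => wt t j) k - broadcast (ew i) (fun t => wt t i) k)
    + α • s k i
  w_mem : ∀ k i, w (k + 1) i ∈ P.W i
  w_min : ∀ k i, IsMinOn (fun x => P.F i x - inner ℝ (wt (k + 1) i) x) (P.W i) (w (k + 1) i)
  s_succ : ∀ k i, s (k + 1) i = s k i
    + (∑ j, C i j • broadcast (es j) (fun t => s t j) k - broadcast (es i) (fun t => s t i) k)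
    - (w (k + 1) i - w k i)

end ETDGT

namespace ETDGT

/-! ET-DGT is a perturbed gradient method on the dual problem. Strong convexity makes the map from
`wt` to `w` cocoercive (`cocoercive_of_isMinOn`), and Slater's condition supplies a multiplier `y`
for which the optimal allocation `Ws` solves the local problems. With `x = wt`, `h = w - Ws`, `q = s
+ h` the run becomes `x⁺ = R x + α (q - h) + ε`, `q⁺ = C q + (h - C h) + ε'`, where `q` has zero sum
and the communication errors `ε`, `ε'` have summable norms. It remains to show `h → 0`.

Powers of `R` and `C` converge geometrically to `1 uᵀ` and `v 1ᵀ` (`exists_stationary`), and the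
common root gives `μ = u ⬝ v > 0`. The average `u ⬝ x` is driven by `u ⬝ q`, not by `∑ h`; adding `α
γ ⬝ q`, with `γ (1 - C) = u - μ 1ᵀ`, removes this term. The corrected average `z` obeys `z⁺ = z - α
μ ∑ h + O(e)` exactly (`tracking_average_succ`), and cocoercivity makes `‖z - y‖²` decrease by a
multiple of `‖h‖²`, up to the disagreement of `x` and the size of `q`.

Both are outputs of stable linear systems driven by `h`, so their square sums are bounded by that of
`h` (`sum_sq_norm_le`). For small `α` these gains cost at most half of the dissipation, so `∑ ‖h‖²`
is finite (`tendsto_zero_of_perturbed_descent`). -/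

/-! ### Powers of nonnegative and stochastic matrices -/

theorem pow_apply_nonneg {n : ℕ} {A : Matrix (Fin n) (Fin n) ℝ} (hA : ∀ i j, 0 ≤ A i j) (k : ℕ)
    (i j : Fin n) : 0 ≤ (A ^ k) i j := by
  induction k generalizing i j with
  | zero => rw [pow_zero, Matrix.one_apply]; split_ifs <;> norm_num
  | succ k ih =>
    rw [pow_succ, Matrix.mul_apply]
    exact Finset.sum_nonneg fun l _ => mul_nonneg (ih i l) (hA l j)

theorem mul_apply_pos {n : ℕ} {A B : Matrix (Fin n) (Fin n) ℝ} (hA : ∀ i j, 0 ≤ A i j)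
    (hB : ∀ i j, 0 ≤ B i j) {i j l : Fin n} (h₁ : 0 < A i l) (h₂ : 0 < B l j) :
    0 < (A * B) i j := by
  rw [Matrix.mul_apply]
  exact Finset.sum_pos' (fun m _ => mul_nonneg (hA i m) (hB m j))
    ⟨l, Finset.mem_univ l, mul_pos h₁ h₂⟩

theorem exists_pow_pos_of_reachable {n : ℕ} {A : Matrix (Fin n) (Fin n) ℝ} (hA : ∀ i j, 0 ≤ A i j)
    {r i : Fin n} (h : Relation.ReflTransGen (fun j i => 0 < A i j) r i) :
    ∃ k, 0 < (A ^ k) i r := by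
  induction h with
  | refl => exact ⟨0, by simp⟩
  | tail _ hbc ih =>
    obtain ⟨k, hk⟩ := ih
    exact ⟨k + 1, by rw [pow_succ']; exact mul_apply_pos hA (pow_apply_nonneg hA k) hbc hk⟩

/-- Return lengths are closed under addition, and a submonoid of `ℕ` whose elements have gcd `1`
contains all large integers. -/
theorem IsAperiodicAt.exists_forall_ge_pos {n : ℕ} {A : Matrix (Fin n) (Fin n) ℝ}
    (hA : ∀ i j, 0 ≤ A i j) {r : Fin n} (h : IsAperiodicAt A r) :
    ∃ N, ∀ k ≥ N, 0 < (A ^ k) r r := by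
  let T : AddSubmonoid ℕ :=
    { carrier := {k | 0 < (A ^ k) r r}
      zero_mem' := by simp
      add_mem' := fun {a b} ha hb => by
        simp only [Set.mem_ofPred_eq] at *
        rw [pow_add]
        exact mul_apply_pos (pow_apply_nonneg hA a) (pow_apply_nonneg hA b) ha hb }
  let s : Set ℕ := {k | 0 < k ∧ 0 < (A ^ k) r r}
  have hgcd : Nat.setGcd s = 1 := h _ fun k hk hk' => Nat.setGcd_dvd_of_mem ⟨hk, hk'⟩
  obtain ⟨N, hN⟩ := Nat.exists_mem_closure_of_ge (s := s)
  have hs : AddSubmonoid.closure s ≤ T := (AddSubmonoid.closure_le).2 fun k hk => hk.2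
  exact ⟨N, fun k hk => hs (hN k hk (by rw [hgcd]; exact one_dvd k))⟩

/-- A path from `r` to `i` is padded to a length independent of `i` by closed walks at `r`, which
exist in every large length. -/
theorem exists_pow_column_pos {n : ℕ} {A : Matrix (Fin n) (Fin n) ℝ}
    (hA : ∀ i j, 0 ≤ A i j) {r : Fin n} (hroot : IsSpanningRoot A r) (h : IsAperiodicAt A r) :
    ∃ N, 0 < N ∧ ∀ i, 0 < (A ^ N) i r := by
  obtain ⟨N, hN⟩ := h.exists_forall_ge_pos hA
  choose k hk using fun i => exists_pow_pos_of_reachable hA (hroot i)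
  refine ⟨∑ i, k i + N + 1, by omega, fun i => ?_⟩
  have hle : k i ≤ ∑ i, k i := Finset.single_le_sum (fun _ _ => Nat.zero_le _) (Finset.mem_univ i)
  have : ∑ i, k i + N + 1 = k i + (∑ i, k i + N + 1 - k i) := by omega
  rw [this, pow_add]
  exact mul_apply_pos (pow_apply_nonneg hA _) (pow_apply_nonneg hA _) (hk i) (hN _ (by omega))

/-- The two distributions share mass `β` at `r`, which cancels in the difference of the means; only
mass `1 - β` can feel the oscillation of `y`. -/
theorem sum_mul_sub_sum_mul_le {n : ℕ} {p p' y : Fin n → ℝ} {r : Fin n} {β D : ℝ}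
    (hp : ∀ i, 0 ≤ p i) (hp' : ∀ i, 0 ≤ p' i) (hs : ∑ i, p i = 1) (hs' : ∑ i, p' i = 1)
    (hr : β ≤ p r) (hr' : β ≤ p' r) (hβ : β ≤ 1) (hy : ∀ i j, y i - y j ≤ D) :
    ∑ i, p i * y i - ∑ i, p' i * y i ≤ (1 - β) * D := by
  have : Nonempty (Fin n) := ⟨r⟩
  obtain ⟨a, ha⟩ := Finite.exists_min y
  obtain ⟨b, hb⟩ := Finite.exists_max y
  have h₁ : β * (y b - y r) ≤ ∑ i, p i * (y b - y i) :=
    (mul_le_mul_of_nonneg_right hr (sub_nonneg.2 (hb r))).trans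
      (Finset.single_le_sum (f := fun i => p i * (y b - y i))
        (fun i _ => mul_nonneg (hp i) (sub_nonneg.2 (hb i))) (Finset.mem_univ r))
  have h₂ : β * (y r - y a) ≤ ∑ i, p' i * (y i - y a) :=
    (mul_le_mul_of_nonneg_right hr' (sub_nonneg.2 (ha r))).trans
      (Finset.single_le_sum (f := fun i => p' i * (y i - y a))
        (fun i _ => mul_nonneg (hp' i) (sub_nonneg.2 (ha i))) (Finset.mem_univ r))
  simp only [mul_sub, Finset.sum_sub_distrib, ← Finset.sum_mul, hs, hs', one_mul] at h₁ h₂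
  have := mul_le_mul_of_nonneg_left (hy b a) (sub_nonneg.2 hβ)
  nlinarith

/-- Doeblin's contraction estimate for the columns of the powers of a row-stochastic matrix. -/
theorem exists_pow_sub_pow_le {n : ℕ} {A : Matrix (Fin n) (Fin n) ℝ}
    (hA : A ∈ Matrix.rowStochastic ℝ (Fin n)) {N : ℕ} {r : Fin n} (hN : 0 < N)
    (hpos : ∀ i, 0 < (A ^ N) i r) :
    ∃ c ρ : ℝ, 0 ≤ c ∧ 0 < ρ ∧ ρ < 1 ∧
      ∀ k i i' j, (A ^ k) i j - (A ^ k) i' j ≤ c * ρ ^ k := by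
  have hpow (k : ℕ) : A ^ k ∈ Matrix.rowStochastic ℝ (Fin n) := pow_mem hA k
  have : Nonempty (Fin n) := ⟨r⟩
  obtain ⟨a, ha⟩ := Finite.exists_min fun i => (A ^ N) i r
  -- Halving keeps `β < 1`, hence `ρ > 0`, even when the column is identically `1`.
  set β := (A ^ N) a r / 2 with hβ
  have hβ0 : 0 < β := half_pos (hpos a)
  have hβ1 : β ≤ 1 / 2 := by
    have := Matrix.le_one_of_mem_rowStochastic (hpow N) (i := a) (j := r)
    linarith
  have hN1 : (1 : ℝ) ≤ N := by exact_mod_cast hN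
  have hdiv : β / N ≤ β := div_le_self hβ0.le hN1
  have hdiv0 : 0 < β / N := by positivity
  set ρ := 1 - β / N with hρ
  have hρ0 : 0 < ρ := by linarith
  have hρ1 : ρ < 1 := by linarith
  -- Bernoulli's inequality replaces an `N`-th root of `1 - β`.
  have hρN : 1 - β ≤ ρ ^ N := by
    have := one_add_mul_le_pow (a := -(β / N)) (by linarith) N
    have h2 : (N : ℝ) * -(β / N) = -β := by field_simp
    rw [h2] at this
    rw [hρ]
    simpa [sub_eq_add_neg] using this
  -- This constant makes the bound at least `1` for `k < N`, where entries in `[0, 1]` suffice.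
  refine ⟨(ρ ^ N)⁻¹, ρ, by positivity, hρ0, hρ1, fun k => ?_⟩
  induction k using Nat.strong_induction_on with
  | _ k ih =>
    intro i i' j
    rcases lt_or_ge k N with hk | hk
    · have h₁ := Matrix.le_one_of_mem_rowStochastic (hpow k) (i := i) (j := j)
      have h₂ := Matrix.nonneg_of_mem_rowStochastic (hpow k) (i := i') (j := j)
      have h₃ : ρ ^ N ≤ ρ ^ k := pow_le_pow_of_le_one hρ0.le hρ1.le hk.le
      have h₄ : 1 ≤ (ρ ^ N)⁻¹ * ρ ^ k := by
        rw [inv_mul_eq_div, one_le_div (by positivity)]; exact h₃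
      linarith
    · obtain ⟨l, rfl⟩ := Nat.exists_eq_add_of_le hk
      rw [pow_add, Matrix.mul_apply, Matrix.mul_apply]
      have h₁ := sum_mul_sub_sum_mul_le (p := (A ^ N) i) (p' := (A ^ N) i')
        (y := fun m => (A ^ l) m j) (r := r) (β := β) (D := (ρ ^ N)⁻¹ * ρ ^ l)
        (fun m => Matrix.nonneg_of_mem_rowStochastic (hpow N))
        (fun m => Matrix.nonneg_of_mem_rowStochastic (hpow N))
        (Matrix.sum_row_of_mem_rowStochastic (hpow N) i)
        (Matrix.sum_row_of_mem_rowStochastic (hpow N) i')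
        (by linarith [ha i]) (by linarith [ha i'])
        (by linarith) (fun i i' => ih l (by omega) i i' j)
      refine h₁.trans ?_
      calc (1 - β) * ((ρ ^ N)⁻¹ * ρ ^ l) ≤ ρ ^ N * ((ρ ^ N)⁻¹ * ρ ^ l) :=
            mul_le_mul_of_nonneg_right hρN (by positivity)
        _ = (ρ ^ N)⁻¹ * (ρ ^ N * ρ ^ l) := by ring
        _ = (ρ ^ N)⁻¹ * ρ ^ (N + l) := by rw [pow_add]

/-- The powers of a row-stochastic matrix whose graph has an aperiodic spanning root `r` converge
geometrically to the matrix all of whose rows are the stationary distribution `u`. -/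
theorem exists_stationary {n : ℕ} {A : Matrix (Fin n) (Fin n) ℝ}
    (hA : A ∈ Matrix.rowStochastic ℝ (Fin n)) {r : Fin n} (hroot : IsSpanningRoot A r)
    (hap : IsAperiodicAt A r) :
    ∃ (u : Fin n → ℝ) (c ρ : ℝ), 0 ≤ c ∧ 0 < ρ ∧ ρ < 1 ∧ (∀ j, 0 ≤ u j) ∧ 0 < u r ∧
      ∑ j, u j = 1 ∧ (∀ j, ∑ i, u i * A i j = u j) ∧
      ∀ k i j, |(A ^ k) i j - u j| ≤ c * ρ ^ k := by
  have hpow (k : ℕ) : A ^ k ∈ Matrix.rowStochastic ℝ (Fin n) := pow_mem hA k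
  obtain ⟨N, hN, hpos⟩ :=
    exists_pow_column_pos (fun i j => Matrix.nonneg_of_mem_rowStochastic hA) hroot hap
  obtain ⟨c, ρ, hc, hρ0, hρ1, hosc⟩ := exists_pow_sub_pow_le hA hN hpos
  -- Rows of `A ^ (l + k)` are convex combinations of rows of `A ^ k`.
  have hmix (k l : ℕ) (i i' j : Fin n) : |(A ^ (l + k)) i j - (A ^ k) i' j| ≤ c * ρ ^ k := by
    have hs := Matrix.sum_row_of_mem_rowStochastic (hpow l) i
    have h₁ : (A ^ (l + k)) i j - (A ^ k) i' j
        = ∑ m, (A ^ l) i m * ((A ^ k) m j - (A ^ k) i' j) := by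
      simp only [mul_sub, Finset.sum_sub_distrib, ← Finset.sum_mul, hs, one_mul]
      rw [pow_add, Matrix.mul_apply]
    rw [h₁]
    calc |∑ m, (A ^ l) i m * ((A ^ k) m j - (A ^ k) i' j)|
        ≤ ∑ m, |(A ^ l) i m * ((A ^ k) m j - (A ^ k) i' j)| := Finset.abs_sum_le_sum_abs _ _
      _ ≤ ∑ m, (A ^ l) i m * (c * ρ ^ k) := by
          refine Finset.sum_le_sum fun m _ => ?_
          have h0 := Matrix.nonneg_of_mem_rowStochastic (hpow l) (i := i) (j := m)
          rw [abs_mul, abs_of_nonneg h0]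
          exact mul_le_mul_of_nonneg_left
            (abs_le.2 ⟨by linarith [hosc k i' m j], hosc k m i' j⟩) h0
      _ = c * ρ ^ k := by rw [← Finset.sum_mul, hs, one_mul]
  have hcauchy (j : Fin n) : CauchySeq fun k => (A ^ k) r j :=
    cauchySeq_of_le_geometric ρ c hρ1 fun k => by
      rw [dist_comm, Real.dist_eq, add_comm]; exact hmix k 1 r r j
  choose u hu using fun j => cauchySeq_tendsto_of_complete (hcauchy j)
  have hbound (k : ℕ) (i j : Fin n) : |(A ^ k) i j - u j| ≤ c * ρ ^ k := by
    have h₁ : Tendsto (fun l => |(A ^ (l + k)) r j - (A ^ k) i j|) atTop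
        (𝓝 |u j - (A ^ k) i j|) :=
      (((hu j).comp (tendsto_add_atTop_nat k)).sub_const _).abs
    rw [abs_sub_comm]
    exact le_of_tendsto' h₁ fun l => hmix k l r i j
  have hlim (i j : Fin n) : Tendsto (fun k => (A ^ k) i j) atTop (𝓝 (u j)) := by
    rw [tendsto_iff_dist_tendsto_zero]
    refine squeeze_zero (fun _ => dist_nonneg) (fun k => hbound k i j) ?_
    simpa using (tendsto_pow_atTop_nhds_zero_of_lt_one hρ0.le hρ1).const_mul c
  have hnn (k i j) : 0 ≤ (A ^ k) i j := Matrix.nonneg_of_mem_rowStochastic (hpow k)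
  refine ⟨u, c, ρ, hc, hρ0, hρ1, fun j => ge_of_tendsto' (hlim r j) fun k => hnn k r j, ?_, ?_,
    fun j => ?_, hbound⟩
  · have : Nonempty (Fin n) := ⟨r⟩
    obtain ⟨a, ha⟩ := Finite.exists_min fun i => (A ^ N) i r
    refine (hpos a).trans_le (ge_of_tendsto' ((hlim r r).comp (tendsto_add_atTop_nat N)) fun k => ?_)
    simp only [Function.comp_apply]
    rw [pow_add, Matrix.mul_apply]
    calc (A ^ N) a r = ∑ m, (A ^ k) r m * (A ^ N) a r := by
          rw [← Finset.sum_mul, Matrix.sum_row_of_mem_rowStochastic (hpow k), one_mul]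
      _ ≤ _ := Finset.sum_le_sum fun m _ => mul_le_mul_of_nonneg_left (ha m) (hnn k r m)
  · refine tendsto_nhds_unique (tendsto_finsetSum Finset.univ fun j _ => hlim r j) ?_
    simp only [Matrix.sum_row_of_mem_rowStochastic (hpow _)]
    exact tendsto_const_nhds
  · refine tendsto_nhds_unique
      (tendsto_finsetSum Finset.univ fun i _ => (hlim r i).mul_const (A i j)) ?_
    refine ((hlim r j).comp (tendsto_add_atTop_nat 1)).congr fun k => ?_
    simp only [Function.comp_apply]
    rw [pow_succ, Matrix.mul_apply]

/-- A left solution `γ` of `γ (1 - C) = u - (u ⬝ v) 1ᵀ` for a matrix whose powers converge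
geometrically to `v 1ᵀ`. -/
theorem exists_resolvent_row {n : ℕ} {C : Matrix (Fin n) (Fin n) ℝ} {v : Fin n → ℝ} {c ρ : ℝ}
    (hρ0 : 0 ≤ ρ) (hρ1 : ρ < 1) (hsum : ∀ j, ∑ i, C i j = 1)
    (hC : ∀ k i j, |(C ^ k) i j - v i| ≤ c * ρ ^ k) (u : Fin n → ℝ) :
    ∃ γ : Fin n → ℝ, ∀ j, γ j - ∑ l, γ l * C l j = u j - ∑ i, u i * v i := by
  -- The solution is the Neumann series `γ = ∑ₖ u (C ^ k - v 1ᵀ)`; since `1ᵀ C = 1ᵀ`, multiplication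
  -- by `C` shifts the series and only the term `k = 0` survives.
  let b (k : ℕ) (j : Fin n) : ℝ := ∑ i, u i * ((C ^ k) i j - v i)
  have hgeo : Summable fun k => c * ρ ^ k := (summable_geometric_of_lt_one hρ0 hρ1).mul_left c
  have hb (j : Fin n) : Summable fun k => b k j := by
    refine summable_sum fun i _ => Summable.mul_left (u i) ?_
    refine Summable.of_norm_bounded hgeo fun k => ?_
    rw [Real.norm_eq_abs]
    exact hC k i j
  have hstep (k : ℕ) (j : Fin n) : ∑ l, b k l * C l j = b (k + 1) j := by
    simp only [b, Finset.sum_mul]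
    rw [Finset.sum_comm]
    refine Finset.sum_congr rfl fun i _ => ?_
    rw [pow_succ, Matrix.mul_apply]
    simp only [mul_assoc, ← Finset.mul_sum, sub_mul, Finset.sum_sub_distrib, hsum, mul_one]
  have hzero (j : Fin n) : b 0 j = u j - ∑ i, u i * v i := by
    simp [b, mul_sub, Finset.sum_sub_distrib, Matrix.one_apply]
  clear_value b
  refine ⟨fun j => ∑' k, b k j, fun j => ?_⟩
  have hmul : ∑ l, (∑' k, b k l) * C l j = ∑' k, b (k + 1) j := by
    simp only [← hstep, ← tsum_mul_right]
    exact (Summable.tsum_finsetSum fun l _ => (hb l).mul_right _).symm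
  beta_reduce
  rw [hmul, (hb j).tsum_eq_zero_add, add_sub_cancel_right, hzero]

/-! ### Matrices acting on families of vectors, and square-sum gains -/

/-- The action of a real matrix on families of vectors. -/
def act {n : ℕ} {V : Type*} [AddCommGroup V] [Module ℝ V] (M : Matrix (Fin n) (Fin n) ℝ)
    (x : Fin n → V) : Fin n → V :=
  fun i => ∑ j, M i j • x j

section Algebra

variable {n : ℕ} {V : Type*} [AddCommGroup V] [Module ℝ V]

theorem act_add (M : Matrix (Fin n) (Fin n) ℝ) (x y : Fin n → V) :
    act M (x + y) = act M x + act M y := by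
  ext i; simp [act, Finset.sum_add_distrib]

theorem act_sub (M : Matrix (Fin n) (Fin n) ℝ) (x y : Fin n → V) :
    act M (x - y) = act M x - act M y := by
  ext i; simp [act, smul_sub, Finset.sum_sub_distrib]

theorem act_smul (M : Matrix (Fin n) (Fin n) ℝ) (a : ℝ) (x : Fin n → V) :
    act M (a • x) = a • act M x := by
  ext i; simp [act, Finset.smul_sum, smul_comm a]

theorem sub_act (M N : Matrix (Fin n) (Fin n) ℝ) (x : Fin n → V) :
    act (M - N) x = act M x - act N x := by
  ext i; simp [act, sub_smul, Finset.sum_sub_distrib]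

theorem one_act (x : Fin n → V) : act 1 x = x := by
  ext i; simp [act, Matrix.one_apply]

theorem mul_act (M N : Matrix (Fin n) (Fin n) ℝ) (x : Fin n → V) :
    act (M * N) x = act M (act N x) := by
  ext i
  simp only [act, Matrix.mul_apply, Finset.sum_smul, Finset.smul_sum, smul_smul]
  exact Finset.sum_comm

theorem sum_smul_act (γ : Fin n → ℝ) (M : Matrix (Fin n) (Fin n) ℝ) (x : Fin n → V) :
    ∑ i, γ i • act M x i = ∑ j, (∑ i, γ i * M i j) • x j := by
  simp only [act, Finset.sum_smul, Finset.smul_sum, smul_smul]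
  exact Finset.sum_comm

theorem sum_act {M : Matrix (Fin n) (Fin n) ℝ} (hM : ∀ j, ∑ i, M i j = 1) (x : Fin n → V) :
    ∑ i, act M x i = ∑ i, x i := by
  have := sum_smul_act (fun _ => 1) M x
  simpa [hM] using this

end Algebra

section Norm

variable {n : ℕ} {V : Type*} [NormedAddCommGroup V] [NormedSpace ℝ V]

theorem norm_sum_smul_le (γ : Fin n → ℝ) (x : Fin n → V) :
    ‖∑ i, γ i • x i‖ ≤ (∑ i, |γ i|) * ‖x‖ := by
  rw [Finset.sum_mul]
  refine norm_sum_le_of_le _ fun i _ => ?_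
  rw [norm_smul, Real.norm_eq_abs]
  exact mul_le_mul_of_nonneg_left (norm_le_pi_norm x i) (abs_nonneg _)

theorem norm_sum_le_card_mul (x : Fin n → V) : ‖∑ i, x i‖ ≤ n * ‖x‖ := by
  simpa using norm_sum_smul_le (fun _ => 1) x

theorem norm_act_le {M : Matrix (Fin n) (Fin n) ℝ} {b : ℝ} (hb : 0 ≤ b)
    (hM : ∀ i j, |M i j| ≤ b) (x : Fin n → V) : ‖act M x‖ ≤ n * b * ‖x‖ := by
  refine (pi_norm_le_iff_of_nonneg (by positivity)).2 fun i => ?_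
  refine (norm_sum_smul_le (M i) x).trans (mul_le_mul_of_nonneg_right ?_ (norm_nonneg _))
  simpa using Finset.sum_le_sum fun j (_ : j ∈ Finset.univ) => hM i j

/-- Square-summability estimate for a linear system whose powers converge geometrically to `Q`,
on the kernel of `Q`. -/
theorem sum_sq_norm_le {M Q : Matrix (Fin n) (Fin n) ℝ} {c ρ : ℝ} (hc : 0 ≤ c) (hρ0 : 0 ≤ ρ)
    (hρ1 : ρ < 1) (hM : ∀ k i j, |(M ^ k - Q) i j| ≤ c * ρ ^ k) {x b : ℕ → Fin n → V}
    (hx : ∀ k, x (k + 1) = act M (x k) + b k) (hx0 : act Q (x 0) = 0)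
    (hb : ∀ k, act Q (b k) = 0) (K : ℕ) :
    ∑ k ∈ Finset.range K, ‖x k‖ ^ 2
      ≤ (n * c / (1 - ρ)) ^ 2 * (‖x 0‖ ^ 2 + ∑ k ∈ Finset.range K, ‖b k‖ ^ 2) := by
  have hpow (t : ℕ) (y : Fin n → V) (hy : act Q y = 0) :
      ‖act (M ^ t) y‖ ≤ n * c * ρ ^ t * ‖y‖ := by
    have h := norm_act_le (by positivity) (hM t) y
    rwa [sub_act, hy, sub_zero, ← mul_assoc] at h
  -- A scalar majorant. Bounding `act (M ^ t) (x k)` for all `t` at once lets the induction close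
  -- with `c` entering only once.
  let y : ℕ → ℝ := fun k => Nat.rec ‖x 0‖ (fun k y => ρ * y + ‖b k‖) k
  have hy (k : ℕ) : y (k + 1) = ρ * y k + ‖b k‖ := rfl
  have hy0 : y 0 = ‖x 0‖ := rfl
  clear_value y
  have hxy (k : ℕ) : ∀ t, ‖act (M ^ t) (x k)‖ ≤ n * c * ρ ^ t * y k := by
    induction k with
    | zero => intro t; rw [hy0]; exact hpow t _ hx0
    | succ k ih =>
      intro t
      rw [hx, act_add, ← mul_act, ← pow_succ, hy]
      calc _ ≤ _ := norm_add_le _ _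
        _ ≤ n * c * ρ ^ (t + 1) * y k + n * c * ρ ^ t * ‖b k‖ :=
            add_le_add (ih (t + 1)) (hpow t _ (hb k))
        _ = _ := by ring
  have hsq (k : ℕ) : ‖x k‖ ^ 2 ≤ (n * c) ^ 2 * y k ^ 2 := by
    have := hxy k 0
    rw [pow_zero, one_act, pow_zero, mul_one] at this
    rw [← mul_pow]
    exact pow_le_pow_left₀ (norm_nonneg _) this 2
  have hρ' : 0 < 1 - ρ := by linarith
  have hsum (K : ℕ) : (1 - ρ) * ∑ k ∈ Finset.range K, y k ^ 2 + y K ^ 2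
      ≤ ‖x 0‖ ^ 2 + (∑ k ∈ Finset.range K, ‖b k‖ ^ 2) / (1 - ρ) := by
    induction K with
    | zero => simp [hy0]
    | succ K ih =>
      rw [Finset.sum_range_succ, Finset.sum_range_succ, add_div, hy]
      -- Convexity of the square at the mean of `y K` and `‖b K‖ / (1 - ρ)` with weights `ρ` and `1
      -- - ρ`.
      have : (ρ * y K + ‖b K‖) ^ 2 ≤ ρ * y K ^ 2 + ‖b K‖ ^ 2 / (1 - ρ) := by
        have h : ρ * y K ^ 2 + ‖b K‖ ^ 2 / (1 - ρ) - (ρ * y K + ‖b K‖) ^ 2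
            = ρ * ((1 - ρ) * y K - ‖b K‖) ^ 2 / (1 - ρ) := by
          field_simp
          ring
        have h' : 0 ≤ ρ * ((1 - ρ) * y K - ‖b K‖) ^ 2 / (1 - ρ) := by positivity
        linarith
      linarith
  have hB : 0 ≤ ∑ k ∈ Finset.range K, ‖b k‖ ^ 2 := Finset.sum_nonneg fun _ _ => by positivity
  have hY : ∑ k ∈ Finset.range K, y k ^ 2
      ≤ (‖x 0‖ ^ 2 + ∑ k ∈ Finset.range K, ‖b k‖ ^ 2) / (1 - ρ) ^ 2 := by
    rw [le_div_iff₀ (by positivity)]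
    have h₁ := mul_le_mul_of_nonneg_left (hsum K) hρ'.le
    rw [mul_add (1 - ρ) (‖x 0‖ ^ 2), mul_div_cancel₀ _ hρ'.ne'] at h₁
    have h₂ : (1 - ρ) * ‖x 0‖ ^ 2 ≤ ‖x 0‖ ^ 2 := by
      nlinarith [mul_nonneg hρ0 (sq_nonneg ‖x 0‖)]
    have h₃ : 0 ≤ (1 - ρ) * y K ^ 2 := by positivity
    linarith
  calc ∑ k ∈ Finset.range K, ‖x k‖ ^ 2 ≤ ∑ k ∈ Finset.range K, (n * c) ^ 2 * y k ^ 2 :=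
        Finset.sum_le_sum fun k _ => hsq k
    _ = (n * c) ^ 2 * ∑ k ∈ Finset.range K, y k ^ 2 := by rw [Finset.mul_sum]
    _ ≤ _ := mul_le_mul_of_nonneg_left hY (by positivity)
    _ = _ := by rw [div_pow]; ring

end Norm

/-! ### Descent of the corrected average and the small-gain argument -/

/-- A Lyapunov argument for real sequences: `a` is a perturbed Lyapunov function, `H` the
dissipated quantity, `G` a nonnegative gain that is at most half of the dissipation up to a
constant. -/
theorem tendsto_zero_of_perturbed_descent {a H G e : ℕ → ℝ} {p t t' A : ℝ} (hp : 0 < p)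
    (ht : 0 ≤ t) (ht' : 0 ≤ t') (he : ∀ k, 0 ≤ e k) (hsum : Summable e)
    (hstep : ∀ k, a (k + 1) ^ 2 ≤ a k ^ 2 - 2 * p * H k ^ 2 + G k + t * e k * a k + t' * e k ^ 2)
    (hG : ∀ K, ∑ k ∈ Finset.range K, G k ≤ A + p * ∑ k ∈ Finset.range K, H k ^ 2) :
    Tendsto H atTop (𝓝 0) := by
  have heE (k : ℕ) : e k ≤ ∑' k, e k := hsum.le_tsum k fun j _ => he j
  have he2 : Summable fun k => e k ^ 2 :=
    Summable.of_nonneg_of_le (fun k => sq_nonneg _)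
      (fun k => by rw [sq]; exact mul_le_mul_of_nonneg_right (heE k) (he k))
      (hsum.mul_left (∑' k, e k))
  have hE2 (K : ℕ) : ∑ k ∈ Finset.range K, e k ^ 2 ≤ ∑' k, e k ^ 2 :=
    he2.sum_le_tsum _ fun _ _ => sq_nonneg _
  have hE (K : ℕ) : ∑ k ∈ Finset.range K, e k ≤ ∑' k, e k :=
    hsum.sum_le_tsum _ fun k _ => he k
  have hE0 : 0 ≤ ∑' k, e k := tsum_nonneg he
  set E := ∑' k, e k
  set B := |a 0 ^ 2 + A + t' * ∑' k, e k ^ 2| with hBdef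
  have hB : a 0 ^ 2 + A + t' * ∑' k, e k ^ 2 ≤ B := le_abs_self _
  have hB0 : 0 ≤ B := abs_nonneg _
  have htel (K : ℕ) : a K ^ 2 + 2 * p * ∑ k ∈ Finset.range K, H k ^ 2
      ≤ a 0 ^ 2 + ∑ k ∈ Finset.range K, G k + t * ∑ k ∈ Finset.range K, e k * a k
        + t' * ∑ k ∈ Finset.range K, e k ^ 2 := by
    induction K with
    | zero => simp
    | succ K ih =>
      simp only [Finset.sum_range_succ]
      linarith [hstep K]
  have hmain (K : ℕ) : a K ^ 2 + p * ∑ k ∈ Finset.range K, H k ^ 2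
      ≤ B + t * ∑ k ∈ Finset.range K, e k * a k := by
    linarith [htel K, hG K, mul_le_mul_of_nonneg_left (hE2 K) ht']
  have hH0 (K : ℕ) : 0 ≤ ∑ k ∈ Finset.range K, H k ^ 2 :=
    Finset.sum_nonneg fun _ _ => sq_nonneg _
  -- With this choice `M ^ 2 = M + B * M + t * E * M ≥ B + t * E * M`, so the bound `a ≤ M`
  -- reproduces itself by strong induction.
  set M := 1 + B + t * E with hM
  have htE : 0 ≤ t * E := mul_nonneg ht hE0
  have hea (K : ℕ) (h : ∀ j < K, a j ≤ M) : ∑ k ∈ Finset.range K, e k * a k ≤ E * M := by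
    calc ∑ k ∈ Finset.range K, e k * a k ≤ ∑ k ∈ Finset.range K, e k * M :=
          Finset.sum_le_sum fun k hk =>
            mul_le_mul_of_nonneg_left (h k (Finset.mem_range.1 hk)) (he k)
      _ = (∑ k ∈ Finset.range K, e k) * M := by rw [Finset.sum_mul]
      _ ≤ E * M := mul_le_mul_of_nonneg_right (hE K) (by linarith)
  have haM (K : ℕ) : a K ≤ M := by
    induction K using Nat.strong_induction_on with
    | _ K ih =>
      refine le_of_sq_le_sq ?_ (by linarith)
      have h₁ := mul_le_mul_of_nonneg_left (hea K ih) ht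
      have h₂ := mul_nonneg hp.le (hH0 K)
      have h₃ : M ^ 2 = M + B * M + t * (E * M) := by rw [sq]; nth_rewrite 1 [hM]; ring
      nlinarith [hmain K]
  have hS : Summable fun k => H k ^ 2 := by
    refine summable_of_sum_range_le (c := (B + t * (E * M)) / p) (fun k => sq_nonneg _) fun K => ?_
    rw [le_div_iff₀ hp]
    have h₁ := mul_le_mul_of_nonneg_left (hea K fun j _ => haM j) ht
    linarith [hmain K, sq_nonneg (a K)]
  have h0 := hS.tendsto_atTop_zero.sqrt
  simp only [Real.sqrt_sq_eq_abs, Real.sqrt_zero] at h0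
  exact (tendsto_zero_iff_abs_tendsto_zero H).2 h0

section Step

variable {n : ℕ} {V : Type*} [NormedAddCommGroup V] [InnerProductSpace ℝ V]

/-- Cocoercivity is available at the individual `x i`; passing to the common point costs the
disagreement and the correction term. -/
theorem inner_sum_ge {u γ : Fin n → ℝ} {x q h : Fin n → V} {y : V} {L α Γ : ℝ} (hα : 0 ≤ α)
    (hΓ : ∑ i, |γ i| ≤ Γ)
    (hco : 1 / L * ‖h‖ ^ 2 ≤ ∑ i, inner ℝ (h i) (x i - y)) :
    1 / L * ‖h‖ ^ 2 - n * ‖h‖ * ‖fun i => x i - ∑ j, u j • x j‖ - α * n * Γ * ‖h‖ * ‖q‖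
      ≤ inner ℝ (∑ i, h i) (∑ i, u i • x i + α • ∑ i, γ i • q i - y) := by
  have h₁ : ∑ i, inner ℝ (h i) (x i - ∑ j, u j • x j)
      ≤ n * ‖h‖ * ‖fun i => x i - ∑ j, u j • x j‖ := by
    calc ∑ i, inner ℝ (h i) (x i - ∑ j, u j • x j)
        ≤ ∑ _i : Fin n, ‖h‖ * ‖fun i => x i - ∑ j, u j • x j‖ := by
          refine Finset.sum_le_sum fun i _ => (real_inner_le_norm _ _).trans ?_
          exact mul_le_mul (norm_le_pi_norm h i)
            (norm_le_pi_norm (fun i => x i - ∑ j, u j • x j) i) (norm_nonneg _) (norm_nonneg _)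
      _ = _ := by simp [mul_assoc]
  have h₂ : -(α * n * Γ * ‖h‖ * ‖q‖) ≤ α * inner ℝ (∑ i, h i) (∑ i, γ i • q i) := by
    have h₃ := neg_le_of_abs_le (abs_real_inner_le_norm (∑ i, h i) (∑ i, γ i • q i))
    have h₄ : ‖∑ i, h i‖ * ‖∑ i, γ i • q i‖ ≤ (n * ‖h‖) * (Γ * ‖q‖) :=
      mul_le_mul (norm_sum_le_card_mul h)
        ((norm_sum_smul_le γ q).trans (mul_le_mul_of_nonneg_right hΓ (norm_nonneg _)))
        (norm_nonneg _) (by positivity)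
    have h₅ := mul_le_mul_of_nonneg_left (h₃.trans' (neg_le_neg h₄)) hα
    linarith
  have h₆ : inner ℝ (∑ i, h i) (∑ i, u i • x i + α • ∑ i, γ i • q i - y)
      = ∑ i, inner ℝ (h i) (x i - y) - ∑ i, inner ℝ (h i) (x i - ∑ j, u j • x j)
        + α * inner ℝ (∑ i, h i) (∑ i, γ i • q i) := by
    rw [← Finset.sum_sub_distrib]
    simp only [← inner_sub_right, sub_sub_sub_cancel_left]
    rw [← sum_inner, ← real_inner_smul_right, ← inner_add_right]
    congr 1
    abel
  linarith

/-- As `∑ q = 0`, `γ (C - 1) q = -u ⬝ q` cancels the drift of `u ⬝ x`, while `γ (1 - C) h` turns `u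
⬝ h` into `μ ∑ h`. -/
theorem tracking_average_succ {R C : Matrix (Fin n) (Fin n) ℝ} {u γ : Fin n → ℝ} {μ α : ℝ}
    (hu : ∀ j, ∑ i, u i * R i j = u j) (hγ : ∀ j, γ j - ∑ l, γ l * C l j = u j - μ)
    {x x' q q' h ε ε' : Fin n → V} (hx : x' = act R x + α • (q - h) + ε)
    (hq : q' = act C q + (h - act C h) + ε') (hq0 : ∑ i, q i = 0) (hε : ∑ i, u i • ε i = 0) :
    ∑ i, u i • x' i + α • ∑ i, γ i • q' i
      = (∑ i, u i • x i + α • ∑ i, γ i • q i) - (α * μ) • ∑ i, h i + α • ∑ i, γ i • ε' i := by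
  have hC (j : Fin n) : ∑ l, γ l * C l j = γ j - u j + μ := by linarith [hγ j]
  have h₁ : ∑ i, u i • x' i
      = ∑ i, u i • x i + α • ∑ i, u i • q i - α • ∑ i, u i • h i := by
    subst hx
    simp only [Pi.add_apply, Pi.smul_apply, Pi.sub_apply, smul_add, Finset.sum_add_distrib,
      sum_smul_act, hu, hε, smul_sub, Finset.sum_sub_distrib, smul_comm _ α, ← Finset.smul_sum]
    abel
  have h₂ : ∑ i, γ i • q' i = ∑ i, γ i • q i - ∑ i, u i • q i + ∑ i, u i • h i - μ • ∑ i, h i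
      + ∑ i, γ i • ε' i := by
    subst hq
    simp only [Pi.add_apply, Pi.sub_apply, smul_add, smul_sub, Finset.sum_add_distrib,
      Finset.sum_sub_distrib, sum_smul_act, hC, add_smul, sub_smul, ← Finset.smul_sum, hq0,
      smul_zero]
    abel
  rw [h₁, h₂]
  simp only [smul_add, smul_sub, mul_smul]
  abel

theorem norm_sub_smul_add_sq_le (z g θ : V) {η : ℝ} :
    ‖z - η • g + θ‖ ^ 2 ≤ ‖z‖ ^ 2 - 2 * η * inner ℝ g z + 2 * ‖θ‖ * ‖z‖ + 2 * η ^ 2 * ‖g‖ ^ 2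
      + 2 * ‖θ‖ ^ 2 := by
  have h₁ : ‖z + (θ - η • g)‖ ^ 2 = ‖z‖ ^ 2 + 2 * inner ℝ z (θ - η • g) + ‖θ - η • g‖ ^ 2 :=
    norm_add_sq_real _ _
  have h₂ : ‖θ - η • g‖ ^ 2 ≤ 2 * ‖θ‖ ^ 2 + 2 * η ^ 2 * ‖g‖ ^ 2 := by
    have h := norm_sub_le θ (η • g)
    rw [norm_smul] at h
    have h' := pow_le_pow_left₀ (norm_nonneg _) h 2
    have h'' : ‖η‖ ^ 2 = η ^ 2 := by rw [Real.norm_eq_abs, sq_abs]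
    nlinarith [sq_nonneg (‖θ‖ - ‖η‖ * ‖g‖)]
  have h₃ := real_inner_le_norm z θ
  have h₄ : z - η • g + θ = z + (θ - η • g) := by abel
  rw [h₄, h₁, inner_sub_right, real_inner_smul_right, real_inner_comm g z]
  linarith

end Step

set_option maxHeartbeats 1000000 in
/-- Dual gradient tracking with a row-stochastic matrix `R`, a column-stochastic matrix `C`, errors
`ε`, `ε'` of summable size, and a cocoercive input `h`: the input tends to `0` if the step size is
small. Here `κR`, `κC` bound the square-summability gains of `R` and `C` off their fixed vectors,
and `γ` is the resolvent row of `exists_resolvent_row`. -/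
theorem tendsto_zero_of_tracking {n : ℕ} {V : Type*} [NormedAddCommGroup V]
    [InnerProductSpace ℝ V] {R C : Matrix (Fin n) (Fin n) ℝ} (hR : R ∈ Matrix.rowStochastic ℝ (Fin n))
    (hC : C ∈ Matrix.colStochastic ℝ (Fin n)) {u v γ : Fin n → ℝ} {cR cC ρR ρC μ : ℝ}
    (hu0 : ∀ i, 0 ≤ u i) (hu1 : ∑ i, u i = 1)
    (hu : ∀ j, ∑ i, u i * R i j = u j) (hγ : ∀ j, γ j - ∑ l, γ l * C l j = u j - μ) (hμ : 0 < μ)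
    (hcR : 0 ≤ cR) (hρR : 0 ≤ ρR) (hρR1 : ρR < 1) (hcC : 0 ≤ cC) (hρC : 0 ≤ ρC) (hρC1 : ρC < 1)
    (hRk : ∀ k i j, |(R ^ k) i j - u j| ≤ cR * ρR ^ k)
    (hCk : ∀ k i j, |(C ^ k) i j - v i| ≤ cC * ρC ^ k)
    {L α Γ κR κC : ℝ} (hL : 0 < L) (hα : 0 < α) (hα1 : α ≤ 1) (hΓ : Γ = ∑ i, |γ i|)
    (hκR : κR = (n * cR / (1 - ρR)) ^ 2) (hκC : κC = 2 * (n * cC / (1 - ρC)) ^ 2 * (1 + n) ^ 2)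
    (hαK : α * (n * Γ + μ * n ^ 2 + n ^ 2 * L * (12 * κR * (κC + 1)) + n * Γ * κC) ≤ 1 / (4 * L))
    {x q h ε ε' : ℕ → Fin n → V} {y : V} {e : ℕ → ℝ}
    (hx : ∀ k, x (k + 1) = act R (x k) + α • (q k - h k) + ε k)
    (hq : ∀ k, q (k + 1) = act C (q k) + (h k - act C (h k)) + ε' k)
    (hq0 : ∑ i, q 0 i = 0) (hεu : ∀ k, ∑ i, u i • ε k i = 0) (hε'0 : ∀ k, ∑ i, ε' k i = 0)
    (hε : ∀ k, ‖ε k‖ ≤ e k) (hε' : ∀ k, ‖ε' k‖ ≤ e k) (he : Summable e)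
    (hco : ∀ k, 1 / L * ‖h k‖ ^ 2 ≤ ∑ i, inner ℝ (h k i) (x k i - y)) :
    Tendsto h atTop (𝓝 0) := by
  have hCs (j : Fin n) : ∑ i, C i j = 1 := Matrix.sum_col_of_mem_colStochastic hC j
  have hRs (i : Fin n) : ∑ j, R i j = 1 := Matrix.sum_row_of_mem_rowStochastic hR i
  have he0 (k : ℕ) : 0 ≤ e k := (norm_nonneg _).trans (hε k)
  have hqs (k : ℕ) : ∑ i, q k i = 0 := by
    induction k with
    | zero => exact hq0
    | succ k ih =>
      simp only [hq, Pi.add_apply, Pi.sub_apply, Finset.sum_add_distrib, Finset.sum_sub_distrib,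
        sum_act hCs, ih, hε'0, sub_self, add_zero]
  have heE (k : ℕ) : e k ≤ ∑' k, e k := he.le_tsum k fun j _ => he0 j
  have he2 : Summable fun k => e k ^ 2 :=
    Summable.of_nonneg_of_le (fun k => sq_nonneg _)
      (fun k => by rw [sq]; exact mul_le_mul_of_nonneg_right (heE k) (he0 k))
      (he.mul_left (∑' k, e k))
  have hE2 (K : ℕ) : ∑ k ∈ Finset.range K, e k ^ 2 ≤ ∑' k, e k ^ 2 :=
    he2.sum_le_tsum _ fun _ _ => sq_nonneg _
  set E₂ := ∑' k, e k ^ 2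
  let δ : ℕ → Fin n → V := fun k i => x k i - ∑ j, u j • x k j
  have hκR0 : 0 ≤ κR := by rw [hκR]; positivity
  have hκC0 : 0 ≤ κC := by rw [hκC]; positivity
  have hΓ0 : 0 ≤ Γ := by rw [hΓ]; exact Finset.sum_nonneg fun _ _ => abs_nonneg _
  -- the gain from `h` to `q`
  have hQ (K : ℕ) : ∑ k ∈ Finset.range K, ‖q k‖ ^ 2
      ≤ (n * cC / (1 - ρC)) ^ 2 * (‖q 0‖ ^ 2 + 2 * E₂)
        + κC * ∑ k ∈ Finset.range K, ‖h k‖ ^ 2 := by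
    have hker (w : Fin n → V) (hw : ∑ i, w i = 0) : act (Matrix.of fun i _ => v i) w = 0 := by
      ext i
      simp only [act, Matrix.of_apply, ← Finset.smul_sum, hw, smul_zero, Pi.zero_apply]
    have h₁ := sum_sq_norm_le (Q := Matrix.of fun i _ => v i) (x := q)
      (b := fun k => (h k - act C (h k)) + ε' k) hcC hρC hρC1 hCk
      (fun k => by rw [hq, add_assoc]) (hker _ hq0)
      (fun k => hker _ (by
        simp only [Pi.add_apply, Pi.sub_apply, Finset.sum_add_distrib, Finset.sum_sub_distrib,
          sum_act hCs, hε'0, sub_self, add_zero])) K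
    have hb (k : ℕ) : ‖(h k - act C (h k)) + ε' k‖ ^ 2
        ≤ 2 * (1 + n) ^ 2 * ‖h k‖ ^ 2 + 2 * e k ^ 2 := by
      have h₂ : ‖act C (h k)‖ ≤ n * 1 * ‖h k‖ := norm_act_le zero_le_one (fun i j => by
        rw [abs_of_nonneg (Matrix.nonneg_of_mem_colStochastic hC)]
        exact Matrix.le_one_of_mem_colStochastic hC) _
      have h₃ : ‖(h k - act C (h k)) + ε' k‖ ≤ (1 + n) * ‖h k‖ + e k := by
        linarith [norm_add_le (h k - act C (h k)) (ε' k), norm_sub_le (h k) (act C (h k)), hε' k]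
      have h₄ := pow_le_pow_left₀ (norm_nonneg _) h₃ 2
      nlinarith [sq_nonneg ((1 + n) * ‖h k‖ - e k)]
    have hbs : ∑ k ∈ Finset.range K, ‖(h k - act C (h k)) + ε' k‖ ^ 2
        ≤ 2 * (1 + n) ^ 2 * ∑ k ∈ Finset.range K, ‖h k‖ ^ 2 + 2 * E₂ := by
      calc _ ≤ ∑ k ∈ Finset.range K, (2 * (1 + n) ^ 2 * ‖h k‖ ^ 2 + 2 * e k ^ 2) :=
            Finset.sum_le_sum fun k _ => hb k
        _ = 2 * (1 + n) ^ 2 * ∑ k ∈ Finset.range K, ‖h k‖ ^ 2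
            + 2 * ∑ k ∈ Finset.range K, e k ^ 2 := by
            rw [Finset.sum_add_distrib, Finset.mul_sum, Finset.mul_sum]
        _ ≤ _ := by linarith [hE2 K]
    refine h₁.trans ((mul_le_mul_of_nonneg_left (add_le_add_right hbs _) (sq_nonneg _)).trans ?_)
    rw [hκC]
    apply le_of_eq
    ring
  set A₁ := (n * cC / (1 - ρC)) ^ 2 * (‖q 0‖ ^ 2 + 2 * E₂)
  -- the gain from `h` to the disagreement `δ`
  have hD (K : ℕ) : ∑ k ∈ Finset.range K, ‖δ k‖ ^ 2
      ≤ κR * (‖δ 0‖ ^ 2 + 12 * α ^ 2 * A₁ + 3 * E₂)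
        + 12 * κR * (κC + 1) * α ^ 2 * ∑ k ∈ Finset.range K, ‖h k‖ ^ 2 := by
    let U : Matrix (Fin n) (Fin n) ℝ := Matrix.of fun _ j => u j
    have hUact (w : Fin n → V) (i : Fin n) : act U w i = ∑ j, u j • w j := rfl
    have hU (w : Fin n → V) : act U (w - act U w) = 0 := by
      ext i
      rw [hUact]
      simp only [Pi.sub_apply, hUact, smul_sub, Finset.sum_sub_distrib, ← Finset.sum_smul, hu1,
        one_smul, sub_self, Pi.zero_apply]
    -- `U R = U = R U`, so the disagreement `δ = (1 - U) x` satisfies a closed recursion in the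
    -- kernel of `U`.
    have hUR (w : Fin n → V) : act U (act R w) = act U w := by
      ext i
      rw [hUact, hUact, sum_smul_act]
      simp only [hu]
    have hRU (w : Fin n → V) : act R (act U w) = act U w := by
      ext i
      rw [act]
      simp only [hUact, ← Finset.sum_smul, hRs, one_smul]
    have hUε (k : ℕ) : act U (ε k) = 0 := by
      ext i
      rw [hUact, hεu, Pi.zero_apply]
    have hUn (w : Fin n → V) : ‖act U w‖ ≤ ‖w‖ := by
      refine (pi_norm_le_iff_of_nonneg (norm_nonneg _)).2 fun i => ?_
      refine (norm_sum_smul_le u w).trans ?_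
      simp only [abs_of_nonneg (hu0 _), hu1, one_mul, le_refl]
    have hδ (k : ℕ) : δ k = x k - act U (x k) := rfl
    have h₁ := sum_sq_norm_le (Q := U) (x := δ)
      (b := fun k => α • ((q k - h k) - act U (q k - h k)) + ε k) hcR hρR hρR1 hRk
      (fun k => by
        rw [hδ, hδ, hx]
        simp only [act_add, act_smul, hUR, hUε, act_sub, hRU, smul_sub]
        abel)
      (hU _) (fun k => by
        rw [act_add, act_smul, hU, hUε, smul_zero, add_zero]) K
    have hb (k : ℕ) : ‖α • ((q k - h k) - act U (q k - h k)) + ε k‖ ^ 2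
        ≤ 12 * α ^ 2 * ‖q k‖ ^ 2 + 12 * α ^ 2 * ‖h k‖ ^ 2 + 3 * e k ^ 2 := by
      have h₂ : ‖(q k - h k) - act U (q k - h k)‖ ≤ 2 * (‖q k‖ + ‖h k‖) := by
        linarith [norm_sub_le (q k - h k) (act U (q k - h k)), hUn (q k - h k),
          norm_sub_le (q k) (h k)]
      have h₃ : ‖α • ((q k - h k) - act U (q k - h k)) + ε k‖
          ≤ 2 * α * ‖q k‖ + 2 * α * ‖h k‖ + e k := by
        have h₄ := norm_add_le (α • ((q k - h k) - act U (q k - h k))) (ε k)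
        rw [norm_smul, Real.norm_of_nonneg hα.le] at h₄
        linarith [hε k, mul_le_mul_of_nonneg_left h₂ hα.le]
      have h₅ := pow_le_pow_left₀ (norm_nonneg _) h₃ 2
      nlinarith [sq_nonneg (2 * α * ‖q k‖ - 2 * α * ‖h k‖), sq_nonneg (2 * α * ‖q k‖ - e k),
        sq_nonneg (2 * α * ‖h k‖ - e k)]
    have hbs : ∑ k ∈ Finset.range K, ‖α • ((q k - h k) - act U (q k - h k)) + ε k‖ ^ 2
        ≤ 12 * α ^ 2 * (A₁ + κC * ∑ k ∈ Finset.range K, ‖h k‖ ^ 2)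
          + 12 * α ^ 2 * ∑ k ∈ Finset.range K, ‖h k‖ ^ 2 + 3 * E₂ := by
      calc _ ≤ ∑ k ∈ Finset.range K,
              (12 * α ^ 2 * ‖q k‖ ^ 2 + 12 * α ^ 2 * ‖h k‖ ^ 2 + 3 * e k ^ 2) :=
            Finset.sum_le_sum fun k _ => hb k
        _ = 12 * α ^ 2 * ∑ k ∈ Finset.range K, ‖q k‖ ^ 2
            + 12 * α ^ 2 * ∑ k ∈ Finset.range K, ‖h k‖ ^ 2
            + 3 * ∑ k ∈ Finset.range K, e k ^ 2 := by
            simp only [Finset.sum_add_distrib, Finset.mul_sum]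
        _ ≤ _ := by
            have := mul_le_mul_of_nonneg_left (hQ K) (by positivity : 0 ≤ 12 * α ^ 2)
            linarith [hE2 K]
    refine h₁.trans ((mul_le_mul_of_nonneg_left (add_le_add_right hbs _) (sq_nonneg _)).trans ?_)
    rw [← hκR]
    apply le_of_eq
    ring
  set A₂ := κR * (‖δ 0‖ ^ 2 + 12 * α ^ 2 * A₁ + 3 * E₂)
  -- descent
  let z : ℕ → V := fun k => ∑ i, u i • x k i + α • ∑ i, γ i • q k i
  have hz (k : ℕ) : z (k + 1) = z k - (α * μ) • ∑ i, h k i + α • ∑ i, γ i • ε' k i :=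
    tracking_average_succ hu hγ (hx k) (hq k) (hqs k) (hεu k)
  have hinner (k : ℕ) : 1 / L * ‖h k‖ ^ 2 - n * ‖h k‖ * ‖δ k‖ - α * n * Γ * ‖h k‖ * ‖q k‖
      ≤ inner ℝ (∑ i, h k i) (z k - y) :=
    inner_sum_ge hα.le hΓ.ge (hco k)
  have hstep (k : ℕ) : ‖z (k + 1) - y‖ ^ 2 ≤ ‖z k - y‖ ^ 2
      - 2 * (α * μ * (3 / (4 * L) - α * n * Γ - α * μ * n ^ 2)) * ‖h k‖ ^ 2
      + 2 * α * μ * (n ^ 2 * L * ‖δ k‖ ^ 2 + α * n * Γ * ‖q k‖ ^ 2)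
      + 2 * α * Γ * e k * ‖z k - y‖ + 2 * (α * Γ) ^ 2 * e k ^ 2 := by
    have h₁ := norm_sub_smul_add_sq_le (z k - y) (∑ i, h k i) (α • ∑ i, γ i • ε' k i)
      (η := α * μ)
    have h₂ : z (k + 1) - y
        = z k - y - (α * μ) • ∑ i, h k i + α • ∑ i, γ i • ε' k i := by rw [hz]; abel
    rw [h₂]
    have hθ : ‖α • ∑ i, γ i • ε' k i‖ ≤ α * Γ * e k := by
      rw [norm_smul, Real.norm_of_nonneg hα.le, mul_assoc]
      refine mul_le_mul_of_nonneg_left ((norm_sum_smul_le γ _).trans ?_) hα.le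
      rw [← hΓ]
      exact mul_le_mul_of_nonneg_left (hε' k) hΓ0
    have hθ2 := pow_le_pow_left₀ (norm_nonneg _) hθ 2
    have hθz := mul_le_mul_of_nonneg_right hθ (norm_nonneg (z k - y))
    have hg := pow_le_pow_left₀ (norm_nonneg _) (norm_sum_le_card_mul (h k)) 2
    have hg' := mul_le_mul_of_nonneg_left hg (by positivity : 0 ≤ 2 * (α * μ) ^ 2)
    -- Young's inequality, weighted to spend `1 / (4 L)` of the `1 / L` from cocoercivity; `3 / (4
    -- L)` remains.
    have hδ : n * ‖h k‖ * ‖δ k‖ ≤ 1 / (4 * L) * ‖h k‖ ^ 2 + n ^ 2 * L * ‖δ k‖ ^ 2 := by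
      have h₃ : 1 / (4 * L) * ‖h k‖ ^ 2 + n ^ 2 * L * ‖δ k‖ ^ 2 - n * ‖h k‖ * ‖δ k‖
          = 1 / (4 * L) * (‖h k‖ - 2 * L * n * ‖δ k‖) ^ 2 := by
        field_simp
        ring
      have h₄ : 0 ≤ 1 / (4 * L) * (‖h k‖ - 2 * L * n * ‖δ k‖) ^ 2 := by positivity
      linarith
    have hqq : α * n * Γ * ‖h k‖ * ‖q k‖ ≤ α * n * Γ * ‖h k‖ ^ 2 + α * n * Γ * ‖q k‖ ^ 2 := by
      have h₃ : 0 ≤ α * n * Γ := by positivity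
      have h₄ : ‖h k‖ * ‖q k‖ ≤ ‖h k‖ ^ 2 + ‖q k‖ ^ 2 := by
        linarith [two_mul_le_add_sq ‖h k‖ ‖q k‖, mul_nonneg (norm_nonneg (h k)) (norm_nonneg (q k))]
      linarith [mul_le_mul_of_nonneg_left h₄ h₃]
    have hL3 : 3 / (4 * L) = 1 / L - 1 / (4 * L) := by field_simp; norm_num
    have hin : (3 / (4 * L) - α * n * Γ) * ‖h k‖ ^ 2 - n ^ 2 * L * ‖δ k‖ ^ 2
        - α * n * Γ * ‖q k‖ ^ 2 ≤ inner ℝ (∑ i, h k i) (z k - y) := by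
      rw [hL3]
      linarith [hinner k]
    have hin' := mul_le_mul_of_nonneg_left hin (by positivity : 0 ≤ 2 * (α * μ))
    linarith
  have hh : Tendsto (fun k => ‖h k‖) atTop (𝓝 0) := by
    have hαμ : 0 < α * μ := mul_pos hα hμ
    have h14 : 3 / (4 * L) = 3 * (1 / (4 * L)) := by ring
    have h14' : 0 < 1 / (4 * L) := by positivity
    have hn : (0 : ℝ) ≤ n := n.cast_nonneg
    have hnΓ : 0 ≤ n * Γ * κC := by positivity
    have hnL : 0 ≤ n ^ 2 * L * (12 * κR * (κC + 1)) := by positivity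
    have hpart : α * n * Γ + α * μ * n ^ 2 ≤ 1 / (4 * L) := by
      linarith [mul_nonneg hα.le (add_nonneg hnL hnΓ)]
    refine tendsto_zero_of_perturbed_descent
      (p := α * μ * (3 / (4 * L) - α * n * Γ - α * μ * n ^ 2))
      (A := 2 * α * μ * (n ^ 2 * L * A₂ + α * n * Γ * A₁))
      (by refine mul_pos hαμ ?_; linarith) (by positivity : 0 ≤ 2 * α * Γ)
      (by positivity : 0 ≤ 2 * (α * Γ) ^ 2) he0 he (a := fun k => ‖z k - y‖) hstep fun K => ?_
    set S := ∑ k ∈ Finset.range K, ‖h k‖ ^ 2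
    have hS : 0 ≤ S := Finset.sum_nonneg fun _ _ => sq_nonneg _
    have h₁ : ∑ k ∈ Finset.range K,
        2 * α * μ * (n ^ 2 * L * ‖δ k‖ ^ 2 + α * n * Γ * ‖q k‖ ^ 2)
        = 2 * α * μ * (n ^ 2 * L * ∑ k ∈ Finset.range K, ‖δ k‖ ^ 2
          + α * n * Γ * ∑ k ∈ Finset.range K, ‖q k‖ ^ 2) := by
      simp only [← Finset.mul_sum, Finset.sum_add_distrib]
    rw [h₁]
    have h₂ := mul_le_mul_of_nonneg_left (hD K) (by positivity : 0 ≤ n ^ 2 * L)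
    have h₃ := mul_le_mul_of_nonneg_left (hQ K) (by positivity : 0 ≤ α * n * Γ)
    have h₄ := mul_le_mul_of_nonneg_left (add_le_add h₂ h₃) (by positivity : 0 ≤ 2 * α * μ)
    refine h₄.trans ?_
    -- This makes the whole smallness condition linear in `α`; it is the reason for `α ≤ 1`.
    have hα2 : α ^ 2 ≤ α := by nlinarith
    have h₅ : n ^ 2 * L * (12 * κR * (κC + 1)) * α ^ 2 + α * n * Γ * κC
        ≤ 1 / (4 * L) - α * n * Γ - α * μ * n ^ 2 := by
      linarith [mul_le_mul_of_nonneg_left hα2 hnL]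
    have h₆ : 2 * (n ^ 2 * L * (12 * κR * (κC + 1)) * α ^ 2 + α * n * Γ * κC)
        ≤ 3 / (4 * L) - α * n * Γ - α * μ * n ^ 2 := by
      have hP : 0 ≤ α * n * Γ + α * μ * n ^ 2 := by positivity
      linarith
    have h₇ := mul_le_mul_of_nonneg_right (mul_le_mul_of_nonneg_left h₆ hαμ.le) hS
    linarith
  exact tendsto_zero_iff_norm_tendsto_zero.2 hh

/-! ### Strong convexity: cocoercivity and existence of minimisers -/

section StronglyConvex

variable {E : Type*} [NormedAddCommGroup E] [InnerProductSpace ℝ E]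

theorem quadratic_growth_of_isMinOn {W : Set E} (hW : Convex ℝ W) {F : E → ℝ} {μ : ℝ} (hμ : 0 ≤ μ)
    (hF : StrongConvexOn Set.univ μ F) {p a b : E} (ha : a ∈ W) (hb : b ∈ W)
    (hmin : IsMinOn (fun x => F x - inner ℝ p x) W a) :
    F a - inner ℝ p a + μ / 2 * ‖a - b‖ ^ 2 ≤ F b - inner ℝ p b := by
  set X := μ / 2 * ‖a - b‖ ^ 2 with hX
  have hX0 : 0 ≤ X := by positivity
  have key (t : ℝ) (ht0 : 0 < t) (ht1 : t < 1) :
      (1 - t) * X ≤ F b - inner ℝ p b - (F a - inner ℝ p a) := by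
    have h₁ := hF.2 (Set.mem_univ a) (Set.mem_univ b) (sub_nonneg.2 ht1.le) ht0.le
      (sub_add_cancel 1 t)
    have h₂ := isMinOn_iff.1 hmin _ (hW ha hb (sub_nonneg.2 ht1.le) ht0.le (sub_add_cancel 1 t))
    simp only [inner_add_right, real_inner_smul_right, smul_eq_mul] at h₁ h₂
    have h₃ : t * ((1 - t) * X) ≤ t * (F b - inner ℝ p b - (F a - inner ℝ p a)) := by
      rw [hX]
      linarith
    exact le_of_mul_le_mul_left h₃ ht0
  set Δ := F b - inner ℝ p b - (F a - inner ℝ p a) with hΔ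
  suffices h : X ≤ Δ by linarith
  by_contra! h
  have hhalf := key (1 / 2) (by norm_num) (by norm_num)
  have hXpos : 0 < X := by linarith
  -- This `t` replaces the limit `t → 0`: it gives `(1 - t) * X = (X + Δ) / 2`, which exceeds `Δ`
  -- when `Δ < X`.
  have h₁ := key ((X - Δ) / (2 * X)) (by apply div_pos <;> linarith)
    (by rw [div_lt_one (by positivity)]; linarith)
  have h₂ : (1 - (X - Δ) / (2 * X)) * X = (X + Δ) / 2 := by
    field_simp
    ring
  linarith

/-- Adding the growth inequalities of the two minimisers cancels all values of `F`. -/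
theorem cocoercive_of_isMinOn {W : Set E} (hW : Convex ℝ W) {F : E → ℝ} {μ : ℝ} (hμ : 0 ≤ μ)
    (hF : StrongConvexOn Set.univ μ F) {p p' a a' : E} (ha : a ∈ W) (ha' : a' ∈ W)
    (hmin : IsMinOn (fun x => F x - inner ℝ p x) W a)
    (hmin' : IsMinOn (fun x => F x - inner ℝ p' x) W a') :
    μ * ‖a - a'‖ ^ 2 ≤ inner ℝ (a - a') (p - p') := by
  have h₁ := quadratic_growth_of_isMinOn hW hμ hF ha ha' hmin
  have h₂ := quadratic_growth_of_isMinOn hW hμ hF ha' ha hmin'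
  rw [norm_sub_rev a' a] at h₂
  rw [real_inner_comm]
  simp only [inner_sub_left, inner_sub_right]
  linarith

end StronglyConvex

theorem norm_sq_le_sum_norm_sq {n : ℕ} {E : Type*} [NormedAddCommGroup E] (x : Fin n → E) :
    ‖x‖ ^ 2 ≤ ∑ i, ‖x i‖ ^ 2 := by
  have h : ‖x‖ ≤ √(∑ i, ‖x i‖ ^ 2) :=
    (pi_norm_le_iff_of_nonneg (Real.sqrt_nonneg _)).2 fun i =>
      Real.le_sqrt_of_sq_le (Finset.single_le_sum (f := fun i => ‖x i‖ ^ 2)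
        (fun _ _ => sq_nonneg _) (Finset.mem_univ i))
  exact (Real.le_sqrt (norm_nonneg _) (Finset.sum_nonneg fun _ _ => sq_nonneg _)).1 h

/-- The product carries the sup norm, whose square is at most the sum of squares, so the modulus is
not reduced. -/
theorem strongConvexOn_sum_apply {n : ℕ} {E : Type*} [NormedAddCommGroup E] [NormedSpace ℝ E]
    {F : Fin n → E → ℝ} {μ : ℝ} (hμ : 0 ≤ μ) (hF : ∀ i, StrongConvexOn Set.univ μ (F i)) :
    StrongConvexOn Set.univ μ fun V : Fin n → E => ∑ i, F i (V i) := by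
  refine ⟨convex_univ, fun V _ U _ a b ha hb hab => ?_⟩
  have h₁ := Finset.sum_le_sum fun i (_ : i ∈ Finset.univ) =>
    (hF i).2 (Set.mem_univ (V i)) (Set.mem_univ (U i)) ha hb hab
  have h₂ := norm_sq_le_sum_norm_sq (V - U)
  have h₄ := mul_le_mul_of_nonneg_left h₂ (by positivity : 0 ≤ a * b * (μ / 2))
  simp only [Finset.sum_sub_distrib, Finset.sum_add_distrib, ← smul_eq_mul, ← Finset.smul_sum,
    Pi.sub_apply] at h₁ h₄
  simp only [Pi.add_apply, Pi.smul_apply, smul_eq_mul] at *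
  linarith

/-- A strongly convex function on a finite-dimensional space attains its minimum on every nonempty
closed set. -/
theorem exists_isMinOn_of_strongConvexOn {E : Type*} [NormedAddCommGroup E] [NormedSpace ℝ E]
    [FiniteDimensional ℝ E] {f : E → ℝ} {μ : ℝ} (hμ : 0 < μ) (hf : StrongConvexOn Set.univ μ f)
    {S : Set E} (hS : IsClosed S) (hne : S.Nonempty) : ∃ x ∈ S, IsMinOn f S x := by
  have : ProperSpace E := FiniteDimensional.proper ℝ E
  have hconv : ConvexOn ℝ Set.univ f := hf.convexOn fun r => by positivity
  have hcont : Continuous f := hconv.locallyLipschitz.continuous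
  obtain ⟨x₀, hx₀⟩ := hne
  obtain ⟨b, -, hb⟩ := (isCompact_closedBall x₀ (1 : ℝ)).exists_isMinOn
    ⟨x₀, Metric.mem_closedBall_self zero_le_one⟩ hcont.continuousOn
  refine hcont.continuousOn.exists_isMinOn' hS hx₀ ?_
  -- If `f x < f x₀`, strong convexity at the point of the segment at distance `1` from `x₀`, where
  -- `f ≥ f b`, forces `‖x - x₀‖ ≤ D`.
  set D := 1 + 2 * (f x₀ - f b) / μ
  have hD : ∀ x, D < ‖x - x₀‖ → f x₀ ≤ f x := by
    intro x hx
    by_contra! hlt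
    have hfb : f b ≤ f x₀ := isMinOn_iff.1 hb _ (Metric.mem_closedBall_self zero_le_one)
    have hD1 : 1 ≤ D := by
      have : 0 ≤ 2 * (f x₀ - f b) / μ := div_nonneg (by linarith) hμ.le
      linarith
    set ρ := ‖x - x₀‖
    have hρ : 1 < ρ := by linarith
    have hρ0 : 0 < ρ := by linarith
    have ht1 : ρ⁻¹ ≤ 1 := inv_le_one_of_one_le₀ hρ.le
    have h₁ := hf.2 (Set.mem_univ x₀) (Set.mem_univ x) (sub_nonneg.2 ht1) (inv_nonneg.2 hρ0.le)
      (sub_add_cancel 1 ρ⁻¹)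
    have h₂ : f b ≤ f ((1 - ρ⁻¹) • x₀ + ρ⁻¹ • x) := by
      refine isMinOn_iff.1 hb _ ?_
      have h₃ : (1 - ρ⁻¹) • x₀ + ρ⁻¹ • x - x₀ = ρ⁻¹ • (x - x₀) := by module
      rw [mem_closedBall_iff_norm, h₃, norm_smul, Real.norm_of_nonneg (inv_nonneg.2 hρ0.le)]
      exact (inv_mul_cancel₀ hρ0.ne').le
    have h₄ : (1 - ρ⁻¹) * ρ⁻¹ * (μ / 2 * ρ ^ 2) = μ / 2 * (ρ - 1) := by
      field_simp
    rw [norm_sub_rev] at h₁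
    simp only [smul_eq_mul] at h₁
    rw [h₄] at h₁
    have h₅ : 2 * (f x₀ - f b) / μ < ρ - 1 := by linarith
    rw [div_lt_iff₀ hμ] at h₅
    have h₆ : ρ⁻¹ * f x ≤ ρ⁻¹ * f x₀ := mul_le_mul_of_nonneg_left hlt.le (inv_nonneg.2 hρ0.le)
    linarith
  refine Eventually.filter_mono inf_le_left ?_
  filter_upwards [(isCompact_closedBall x₀ D).compl_mem_cocompact] with x hx
  refine hD x ?_
  simpa [dist_eq_norm] using hx

/-! ### Lagrange multipliers under the relative-interior Slater condition -/

theorem exists_sub_smul_mem_of_mem_intrinsicInterior {E : Type*} [NormedAddCommGroup E]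
    [NormedSpace ℝ E] {S : Set E} {x y : E} (hx : x ∈ intrinsicInterior ℝ S) (hy : y ∈ S) :
    ∃ t : ℝ, 0 < t ∧ x - t • (y - x) ∈ S := by
  obtain ⟨x', hx', rfl⟩ := hx
  have hmem (t : ℝ) : AffineMap.lineMap (x' : E) y (-t) ∈ affineSpan ℝ S :=
    AffineMap.lineMap_mem _ x'.2 (subset_affineSpan ℝ S hy)
  let g : ℝ → affineSpan ℝ S := fun t => ⟨AffineMap.lineMap (x' : E) y (-t), hmem t⟩
  have hg : Continuous g := by
    refine Continuous.subtype_mk ?_ _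
    exact AffineMap.lineMap_continuous.comp continuous_neg
  have hg0 : g 0 = x' := Subtype.ext (by simp [g])
  have hev : ∀ᶠ t in 𝓝 (0 : ℝ), g t ∈ ((↑) ⁻¹' S : Set (affineSpan ℝ S)) := by
    refine hg.continuousAt.eventually ?_
    rw [hg0]
    exact mem_interior_iff_mem_nhds.1 hx'
  obtain ⟨t, ht, ht0⟩ := ((hev.filter_mono nhdsWithin_le_nhds).and
    (self_mem_nhdsWithin : Set.Ioi (0 : ℝ) ∈ 𝓝[>] 0)).exists
  refine ⟨t, ht0, ?_⟩
  have h₁ : (x' : E) - t • (y - x') = AffineMap.lineMap (x' : E) y (-t) := by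
    rw [AffineMap.lineMap_apply, vsub_eq_sub, vadd_eq_add]
    module
  rw [h₁]
  exact ht

/-- Existence of a Lagrange multiplier for a linearly constrained convex problem under Slater's
condition in relative-interior form. -/
theorem exists_lagrange_multiplier {E V : Type*} [NormedAddCommGroup E] [NormedSpace ℝ E]
    [AddCommGroup V] [Module ℝ V] {S : Set E} {f : E → ℝ} (hf : ConvexOn ℝ S f) (A : E →ₗ[ℝ] V)
    {b : V} {x₀ xs : E} (hx₀ : x₀ ∈ intrinsicInterior ℝ S) (hx₀b : A x₀ = b) (hxs : xs ∈ S)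
    (hxsb : A xs = b) (hmin : ∀ x ∈ S, A x = b → f xs ≤ f x) :
    ∃ l : V →ₗ[ℝ] ℝ, ∀ x ∈ S, f xs ≤ f x + l (A x - b) := by
  have hcomb {c₁ c₂ : ℝ} (h₁ : 0 < c₁) (h₂ : 0 < c₂) {x₁ x₂ : E} (hx₁ : x₁ ∈ S) (hx₂ : x₂ ∈ S) :
      ∃ x ∈ S, c₁ • (A x₁ - b) + c₂ • (A x₂ - b) = (c₁ + c₂) • (A x - b) ∧
        (c₁ + c₂) * f x ≤ c₁ * f x₁ + c₂ * f x₂ := by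
    have hc : 0 < c₁ + c₂ := add_pos h₁ h₂
    have h₃ : 0 ≤ c₁ / (c₁ + c₂) := by positivity
    have h₄ : 0 ≤ c₂ / (c₁ + c₂) := by positivity
    have h₅ : c₁ / (c₁ + c₂) + c₂ / (c₁ + c₂) = 1 := by field_simp
    refine ⟨_, hf.1 hx₁ hx₂ h₃ h₄ h₅, ?_, ?_⟩
    · simp only [map_add, map_smul, smul_sub, smul_add, smul_smul, mul_div_cancel₀ _ hc.ne',
        add_smul]
      abel
    · have h₆ := mul_le_mul_of_nonneg_left (hf.2 hx₁ hx₂ h₃ h₄ h₅) hc.le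
      refine h₆.trans_eq ?_
      simp only [smul_eq_mul]
      field_simp
  -- The cone generated by `A S - b` is a subspace: at the Slater point every direction into `S` can
  -- be reversed.
  let M : Submodule ℝ V :=
    { carrier := {w | ∃ c : ℝ, 0 < c ∧ ∃ x ∈ S, w = c • (A x - b)}
      zero_mem' := ⟨1, one_pos, xs, hxs, by simp [hxsb]⟩
      add_mem' := by
        rintro _ _ ⟨c₁, h₁, x₁, hx₁, rfl⟩ ⟨c₂, h₂, x₂, hx₂, rfl⟩
        obtain ⟨x, hx, h, -⟩ := hcomb h₁ h₂ hx₁ hx₂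
        exact ⟨c₁ + c₂, add_pos h₁ h₂, x, hx, h⟩
      smul_mem' := by
        rintro a _ ⟨c, hc, x, hx, rfl⟩
        rcases lt_trichotomy a 0 with ha | rfl | ha
        · obtain ⟨t, ht, hxt⟩ := exists_sub_smul_mem_of_mem_intrinsicInterior hx₀ hx
          refine ⟨-a * c / t, div_pos (mul_pos (neg_pos.2 ha) hc) ht, _, hxt, ?_⟩
          have h₁ : A (x₀ - t • (x - x₀)) - b = (-t) • (A x - b) := by
            simp only [map_sub, map_smul, hx₀b]
            module
          rw [h₁, smul_smul, smul_smul]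
          congr 1
          field_simp
        · exact ⟨1, one_pos, xs, hxs, by simp [hxsb]⟩
        · exact ⟨a * c, mul_pos ha hc, x, hx, smul_smul _ _ _⟩ }
  -- The cone over the epigraph of the perturbed values. Taking it over `M` rather than `V` gives
  -- the domination that `riesz_extension` requires; optimality of `xs` gives positivity of `g₀` on
  -- the vertical axis.
  let s : PointedCone ℝ (M × ℝ) :=
    { carrier := {p | ∃ c : ℝ, 0 < c ∧ ∃ x ∈ S, (p.1 : V) = c • (A x - b) ∧
        c * (f x - f xs) ≤ p.2}
      zero_mem' := ⟨1, one_pos, xs, hxs, by simp [hxsb]⟩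
      add_mem' := by
        rintro p p' ⟨c₁, h₁, x₁, hx₁, hp, hp'⟩ ⟨c₂, h₂, x₂, hx₂, hq, hq'⟩
        obtain ⟨x, hx, h, h'⟩ := hcomb h₁ h₂ hx₁ hx₂
        refine ⟨c₁ + c₂, add_pos h₁ h₂, x, hx, ?_, ?_⟩
        · rw [← h, Prod.fst_add, Submodule.coe_add, hp, hq]
        · rw [Prod.snd_add]
          linarith
      smul_mem' := by
        rintro ⟨a, ha⟩ p ⟨c, hc, x, hx, hp, hp'⟩
        rcases ha.eq_or_lt with rfl | ha'
        · exact ⟨1, one_pos, xs, hxs, by simp [hxsb], by simp⟩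
        · refine ⟨a * c, mul_pos ha' hc, x, hx, ?_, ?_⟩
          · rw [mul_smul, ← hp]
            rfl
          · rw [mul_assoc]
            exact mul_le_mul_of_nonneg_left hp' ha }
  let g₀ : (M × ℝ) →ₗ.[ℝ] ℝ :=
    ⟨LinearMap.ker (LinearMap.fst ℝ M ℝ), (LinearMap.snd ℝ M ℝ).domRestrict _⟩
  obtain ⟨g, hg₀, hg⟩ := riesz_extension s g₀
    (by
      rintro ⟨⟨w, τ⟩, hw⟩ ⟨c, hc, x, hx, hp, hp'⟩
      have hw0 : w = 0 := hw
      subst hw0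
      have h₁ : A x = b := by
        have h₂ : c • (A x - b) = 0 := by rw [← hp]; rfl
        exact sub_eq_zero.1 ((smul_eq_zero.1 h₂).resolve_left hc.ne')
      exact (mul_nonneg hc.le (sub_nonneg.2 (hmin x hx h₁))).trans hp')
    (by
      rintro ⟨⟨w, c, hc, x, hx, rfl⟩, τ⟩
      refine ⟨⟨(0, c * (f x - f xs) - τ), rfl⟩, c, hc, x, hx, ?_, ?_⟩
      · simp
      · simp)
  obtain ⟨l, hl⟩ := LinearMap.exists_extend (g.comp (LinearMap.inl ℝ M ℝ))
  refine ⟨l, fun x hx => ?_⟩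
  have hxM : A x - b ∈ M := ⟨1, one_pos, x, hx, (one_smul _ _).symm⟩
  have h₁ : l (A x - b) = g (⟨A x - b, hxM⟩, 0) := LinearMap.congr_fun hl ⟨A x - b, hxM⟩
  have h₂ : g (0, f x - f xs) = f x - f xs := hg₀ ⟨(0, f x - f xs), rfl⟩
  have h₃ : 0 ≤ g (⟨A x - b, hxM⟩, f x - f xs) :=
    hg _ ⟨1, one_pos, x, hx, (one_smul _ _).symm, (one_mul _).le⟩
  have h₄ : ((⟨A x - b, hxM⟩, f x - f xs) : M × ℝ) = (⟨A x - b, hxM⟩, 0) + (0, f x - f xs) := by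
    simp
  rw [h₄, map_add, ← h₁, h₂] at h₃
  linarith

/-! ### The optimal allocation and its multiplier -/

namespace Problem

variable {n m : ℕ} {P : Problem n m}

theorem exists_unique_optimal {μ : ℝ} (hμ : 0 < μ) (hcl : ∀ i, IsClosed (P.W i))
    (hconv : ∀ i, Convex ℝ (P.W i)) (hF : ∀ i, StrongConvexOn Set.univ μ (P.F i))
    (hP : P.Slater) : ∃ V, P.IsOptimal V ∧ ∀ U, P.IsOptimal U → U = V := by
  have hsc := strongConvexOn_sum_apply hμ.le hF
  let S : Set (Fin n → Vec m) := {V | P.IsFeasible V}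
  have hS : S = Set.univ.pi P.W ∩ {V | ∑ i, V i = ∑ i, P.d i} := by
    ext V
    simp [S, IsFeasible]
  have hScl : IsClosed S := by
    rw [hS]
    refine (isClosed_set_pi fun i _ => hcl i).inter (isClosed_eq ?_ continuous_const)
    exact continuous_finsetSum _ fun i _ => continuous_apply i
  have hSconv : Convex ℝ S := by
    rw [hS]
    refine (convex_pi fun i _ => hconv i).inter fun V hV U hU a b _ _ hab => ?_
    rw [Set.mem_ofPred_eq] at hV hU ⊢
    simp only [Pi.add_apply, Pi.smul_apply, Finset.sum_add_distrib, ← Finset.smul_sum, hV, hU,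
      ← add_smul, hab, one_smul]
  obtain ⟨V₀, hV₀, hV₀d⟩ := hP
  obtain ⟨V, hV, hmin⟩ := exists_isMinOn_of_strongConvexOn hμ hsc hScl
    ⟨V₀, by rw [hS]; exact ⟨intrinsicInterior_subset hV₀, hV₀d⟩⟩
  refine ⟨V, ⟨hV, fun U hU => isMinOn_iff.1 hmin U hU⟩, fun U hU => ?_⟩
  exact ((hsc.strictConvexOn hμ).subset (Set.subset_univ S) hSconv).eq_of_isMinOn
    (isMinOn_iff.2 fun T hT => hU.2 T hT) hmin hU.1 hV

theorem IsOptimal.exists_multiplier (hconv : ∀ i, Convex ℝ (P.W i))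
    (hF : ∀ i, ConvexOn ℝ Set.univ (P.F i)) (hP : P.Slater) {V : Fin n → Vec m}
    (hV : P.IsOptimal V) :
    ∃ y : Vec m, ∀ i, IsMinOn (fun x => P.F i x - inner ℝ y x) (P.W i) (V i) := by
  obtain ⟨V₀, hV₀, hV₀d⟩ := hP
  let A : (Fin n → Vec m) →ₗ[ℝ] Vec m := ∑ i, LinearMap.proj i
  have hA (U : Fin n → Vec m) : A U = ∑ i, U i := by simp [A]
  have hsum : ConvexOn ℝ (Set.univ.pi P.W) fun U : Fin n → Vec m => ∑ i, P.F i (U i) := by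
    refine ⟨convex_pi fun i _ => hconv i, fun U _ U' _ a b ha hb hab => ?_⟩
    rw [Finset.smul_sum, Finset.smul_sum, ← Finset.sum_add_distrib]
    exact Finset.sum_le_sum fun i _ => (hF i).2 (Set.mem_univ _) (Set.mem_univ _) ha hb hab
  obtain ⟨l, hl⟩ := exists_lagrange_multiplier hsum A hV₀ ((hA _).trans hV₀d)
    (fun i _ => hV.1.1 i) ((hA _).trans hV.1.2)
    (fun U hU hUd => hV.2 U ⟨fun i => hU i (Set.mem_univ i), (hA U).symm.trans hUd⟩)
  let y : Vec m := (InnerProductSpace.toDual ℝ (Vec m)).symm (-l).toContinuousLinearMap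
  have hy (x : Vec m) : inner ℝ y x = -l x := by
    simp [y]
  refine ⟨y, fun i => isMinOn_iff.2 fun x hx => ?_⟩
  classical
  -- Changing one coordinate of `V` splits the Lagrangian inequality into local ones.
  have h₁ := hl (Function.update V i x) (fun j _ => by
    rcases eq_or_ne j i with rfl | hj
    · simpa using hx
    · simpa [hj] using hV.1.1 j)
  have h₂ : A (Function.update V i x) - ∑ i, P.d i = x - V i := by
    rw [hA, ← hV.1.2, Finset.sum_update_of_mem (Finset.mem_univ i),
      ← Finset.add_sum_erase _ _ (Finset.mem_univ i), Finset.sdiff_singleton_eq_erase]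
    abel
  have h₃ : ∑ j, P.F j (Function.update V i x j) - ∑ j, P.F j (V j) = P.F i x - P.F i (V i) := by
    rw [← Finset.sum_sub_distrib, Finset.sum_eq_single i]
    · simp
    · intro j _ hj
      simp [hj]
    · simp
  rw [h₂, map_sub] at h₁
  rw [hy, hy]
  linarith

end Problem

/-! ### The event-triggered run as a perturbed linear system -/

theorem norm_broadcast_sub_le {m : ℕ} {e : ℕ → ℝ} {v : ℕ → Vec m} {k : ℕ} {E : ℝ} (hE : 0 ≤ E)
    (he : e k ≤ E) : ‖broadcast e v k - v k‖ ≤ E := by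
  cases k with
  | zero => simpa [broadcast] using hE
  | succ k =>
    rw [broadcast]
    split_ifs with h
    · simpa using hE
    · rw [norm_sub_rev]
      exact (not_le.1 h).le.trans he

theorem le_maxThreshold {n : ℕ} (ew es : Fin n → ℕ → ℝ) (i : Fin n) (k : ℕ) :
    ew i k ≤ maxThreshold ew es k ∧ es i k ≤ maxThreshold ew es k := by
  have h : max (ew i k) (es i k) ≤ maxThreshold ew es k :=
    le_ciSup (f := fun i => max (ew i k) (es i k)) (Finite.bddAbove_range _) i
  exact ⟨(le_max_left _ _).trans h, (le_max_right _ _).trans h⟩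

/-- Communication errors of the broadcast values of a family of signals. -/
noncomputable def commError {n m : ℕ} (e : Fin n → ℕ → ℝ) (v : ℕ → Fin n → Vec m) (k : ℕ) : Fin n → Vec m :=
  fun i => broadcast (e i) (fun t => v t i) k - v k i

namespace IsRun

variable {n m : ℕ} {P : Problem n m} {R C : Matrix (Fin n) (Fin n) ℝ} {α : ℝ}
  {ew es : Fin n → ℕ → ℝ} {wt w s : ℕ → Fin n → Vec m}

theorem wt_succ_eq (h : IsRun P R C α ew es wt w s) (hR : ∀ i, ∑ j, R i j = 1) (k : ℕ) :
    wt (k + 1) = act R (wt k) + α • s k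
      + (act R (commError ew wt k) - commError ew wt k) := by
  ext1 i
  rw [h.wt_succ]
  simp only [Pi.add_apply, Pi.smul_apply, Pi.sub_apply, act, commError, smul_sub,
    Finset.sum_sub_distrib, ← Finset.sum_smul, hR, one_smul]
  abel

theorem s_succ_eq (h : IsRun P R C α ew es wt w s) (k : ℕ) :
    s (k + 1) = act C (s k) + (act C (commError es s k) - commError es s k)
      - (w (k + 1) - w k) := by
  ext1 i
  rw [h.s_succ]
  simp only [Pi.add_apply, Pi.sub_apply, act, commError, smul_sub, Finset.sum_sub_distrib]
  abel

/-- Column-stochasticity conserves this total even under stale broadcasts; it is what gives `q` zero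
sum. -/
theorem sum_s_add_sum_w (h : IsRun P R C α ew es wt w s) (hC : ∀ j, ∑ i, C i j = 1) (k : ℕ) :
    ∑ i, s k i + ∑ i, w k i = ∑ i, P.d i := by
  induction k with
  | zero => simp only [h.s_zero, Finset.sum_sub_distrib, sub_add_cancel]
  | succ k ih =>
    rw [← ih, h.s_succ_eq]
    simp only [Pi.add_apply, Pi.sub_apply, Finset.sum_add_distrib, Finset.sum_sub_distrib,
      sum_act hC]
    abel

end IsRun

theorem norm_commError_le {n m : ℕ} {e : Fin n → ℕ → ℝ} {v : ℕ → Fin n → Vec m} {k : ℕ} {E : ℝ}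
    (hE : 0 ≤ E) (he : ∀ i, e i k ≤ E) : ‖commError e v k‖ ≤ E :=
  (pi_norm_le_iff_of_nonneg hE).2 fun i => norm_broadcast_sub_le hE (he i)

theorem norm_act_sub_self_le {n : ℕ} {V : Type*} [NormedAddCommGroup V] [NormedSpace ℝ V]
    {M : Matrix (Fin n) (Fin n) ℝ} (h0 : ∀ i j, 0 ≤ M i j) (h1 : ∀ i j, M i j ≤ 1)
    {x : Fin n → V} {E : ℝ} (hx : ‖x‖ ≤ E) : ‖act M x - x‖ ≤ (n + 1) * E := by
  have h₁ : ‖act M x‖ ≤ n * 1 * ‖x‖ :=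
    norm_act_le zero_le_one (fun i j => by rw [abs_of_nonneg (h0 i j)]; exact h1 i j) x
  have h₂ : (n + 1) * ‖x‖ ≤ (n + 1) * E := mul_le_mul_of_nonneg_left hx (by positivity)
  linarith [norm_sub_le (act M x) x]

end ETDGT

/-! ### Convergence of ET-DGT -/

theorem theorem3 (n : ℕ) (R C : Matrix (Fin n) (Fin n) ℝ)
    (hR : R ∈ Matrix.rowStochastic ℝ (Fin n)) (hC : C ∈ Matrix.colStochastic ℝ (Fin n))
    (hroot : ∃ r : Fin n, ETDGT.IsSpanningRoot R r ∧ ETDGT.IsSpanningRoot Cᵀ r ∧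
      ETDGT.IsAperiodicAt R r ∧ ETDGT.IsAperiodicAt Cᵀ r)
    (L : ℝ) (hL : 0 < L) :
    ∃ αbar : ℝ, 0 < αbar ∧
      ∀ (m : ℕ) (P : ETDGT.Problem n m),
        (∀ i, IsClosed (P.W i)) → (∀ i, Convex ℝ (P.W i)) →
        (∀ i, StrongConvexOn Set.univ (1 / L) (P.F i)) → P.Slater →
        ∃ Wstar : Fin n → ETDGT.Vec m,
          P.IsOptimal Wstar ∧ (∀ V, P.IsOptimal V → V = Wstar) ∧
          ∀ (ew es : Fin n → ℕ → ℝ),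
            Antitone (ETDGT.maxThreshold ew es) → Summable (ETDGT.maxThreshold ew es) →
            ∀ α : ℝ, 0 < α → α < αbar →
              ∀ wt w s : ℕ → Fin n → ETDGT.Vec m,
                ETDGT.IsRun P R C α ew es wt w s → Tendsto w atTop (𝓝 Wstar) := by
  obtain ⟨r, hrR, hrC, haR, haC⟩ := hroot
  have hCt : Cᵀ ∈ Matrix.rowStochastic ℝ (Fin n) :=
    Matrix.transpose_mem_rowStochastic_iff_mem_colStochastic.2 hC
  obtain ⟨u, cR, ρR, hcR, hρR, hρR1, hu0, hur, hu1, hu, hRk⟩ := ETDGT.exists_stationary hR hrR haR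
  obtain ⟨v, cC, ρC, hcC, hρC, hρC1, hv0, hvr, -, -, hCk'⟩ := ETDGT.exists_stationary hCt hrC haC
  have hCk (k : ℕ) (i j : Fin n) : |(C ^ k) i j - v i| ≤ cC * ρC ^ k := by
    have h := hCk' k j i
    rwa [← Matrix.transpose_pow, Matrix.transpose_apply] at h
  have hRs (i : Fin n) : ∑ j, R i j = 1 := Matrix.sum_row_of_mem_rowStochastic hR i
  have hCs (j : Fin n) : ∑ i, C i j = 1 := Matrix.sum_col_of_mem_colStochastic hC j
  obtain ⟨γ, hγ⟩ := ETDGT.exists_resolvent_row hρC.le hρC1 hCs hCk u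
  have hμ : 0 < ∑ i, u i * v i :=
    Finset.sum_pos' (fun i _ => mul_nonneg (hu0 i) (hv0 i)) ⟨r, Finset.mem_univ r, mul_pos hur hvr⟩
  set μ := ∑ i, u i * v i
  set Γ := ∑ i, |γ i| with hΓ
  set κR := (n * cR / (1 - ρR)) ^ 2 with hκR
  set κC := 2 * (n * cC / (1 - ρC)) ^ 2 * (1 + n) ^ 2 with hκC
  set K := n * Γ + μ * n ^ 2 + n ^ 2 * L * (12 * κR * (κC + 1)) + n * Γ * κC with hK
  have hΓ0 : 0 ≤ Γ := Finset.sum_nonneg fun _ _ => abs_nonneg _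
  have hκR0 : 0 ≤ κR := by positivity
  have hκC0 : 0 ≤ κC := by positivity
  have hK0 : 0 ≤ K := by positivity
  -- `K + 1` avoids division by zero; `m`, `P` and the thresholds are introduced only after the
  -- bound is fixed.
  refine ⟨min 1 (1 / (4 * L) / (K + 1)), by positivity, fun m P hcl hconv hF hP => ?_⟩
  have hL' : 0 < 1 / L := by positivity
  obtain ⟨Ws, hWs, huniq⟩ := ETDGT.Problem.exists_unique_optimal hL' hcl hconv hF hP
  refine ⟨Ws, hWs, huniq, fun ew es hanti hsum α hα hαlt wt w s hrun => ?_⟩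
  obtain ⟨y, hy⟩ := hWs.exists_multiplier hconv
    (fun i => (hF i).convexOn fun r => by positivity) hP
  -- Individual thresholds may be negative; their maximum is not, as it decreases to `0`.
  have he0 (k : ℕ) : 0 ≤ ETDGT.maxThreshold ew es k :=
    hanti.le_of_tendsto hsum.tendsto_atTop_zero k
  have hα1 : α ≤ 1 := (hαlt.trans_le (min_le_left _ _)).le
  have hαK : α * K ≤ 1 / (4 * L) := by
    have h := (hαlt.trans_le (min_le_right _ _)).le
    rw [le_div_iff₀ (by positivity)] at h
    linarith
  have hεw (k : ℕ) := ETDGT.norm_commError_le (v := wt) (he0 k)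
    fun i => (ETDGT.le_maxThreshold ew es i k).1
  have hεs (k : ℕ) := ETDGT.norm_commError_le (v := s) (he0 k)
    fun i => (ETDGT.le_maxThreshold ew es i k).2
  have hlim : Tendsto (fun k => w (k + 1) - Ws) atTop (𝓝 0) := by
    -- Time is shifted by one because `w 0 = 0` need not be feasible or solve the local problem.
    refine ETDGT.tendsto_zero_of_tracking hR hC hu0 hu1 hu hγ hμ hcR hρR.le hρR1 hcC hρC.le hρC1
      hRk hCk hL hα hα1 hΓ hκR hκC hαK (x := fun k => wt (k + 1))
      (q := fun k => s (k + 1) + (w (k + 1) - Ws))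
      (ε := fun k => ETDGT.act R (ETDGT.commError ew wt (k + 1))
        - ETDGT.commError ew wt (k + 1))
      (ε' := fun k => ETDGT.act C (ETDGT.commError es s (k + 1))
        - ETDGT.commError es s (k + 1))
      (y := y) (e := fun k => (n + 1) * ETDGT.maxThreshold ew es (k + 1))
      (fun k => ?_) (fun k => ?_) ?_ (fun k => ?_) (fun k => ?_)
      (fun k => ETDGT.norm_act_sub_self_le
        (fun i j => Matrix.nonneg_of_mem_rowStochastic hR)
        (fun i j => Matrix.le_one_of_mem_rowStochastic hR) (hεw (k + 1)))
      (fun k => ETDGT.norm_act_sub_self_le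
        (fun i j => Matrix.nonneg_of_mem_colStochastic hC)
        (fun i j => Matrix.le_one_of_mem_colStochastic hC) (hεs (k + 1)))
      (((summable_nat_add_iff 1).2 hsum).mul_left _) (fun k => ?_)
    · rw [add_sub_cancel_right]
      exact hrun.wt_succ_eq hRs (k + 1)
    · simp only [hrun.s_succ_eq (k + 1), ETDGT.act_add]
      abel
    · have h := hrun.sum_s_add_sum_w hCs 1
      simp only [zero_add, Pi.add_apply, Pi.sub_apply, Finset.sum_add_distrib,
        Finset.sum_sub_distrib, hWs.1.2, ← h]
      abel
    · simp only [Pi.sub_apply, smul_sub, Finset.sum_sub_distrib, ETDGT.sum_smul_act, hu, sub_self]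
    · simp only [Pi.sub_apply, Finset.sum_sub_distrib, ETDGT.sum_act hCs, sub_self]
    · refine (mul_le_mul_of_nonneg_left (ETDGT.norm_sq_le_sum_norm_sq _) hL'.le).trans ?_
      rw [Finset.mul_sum]
      exact Finset.sum_le_sum fun i _ => ETDGT.cocoercive_of_isMinOn (hconv i) hL'.le (hF i)
        (hrun.w_mem k i) (hWs.1.1 i) (hrun.w_min k i) (hy i)
  refine (tendsto_add_atTop_iff_nat 1).1 ?_
  simpa using hlim.add_const Ws
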